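/- All graphs are finite and simple. The degree sequence of a graph is the list of the degrees of all its vertices in non-increasing order, and the graph is called a realization of that sequence. A graph is self-complementary if it is isomorphic to its complement. A degree sequence (that is, a sequence with at least one realization) is forcibly self-complementary if all of its realizations are self-complementary. Write $(d_i^{n_i})_{i=1}^{\ell}$ with $d_1 > d_2 > \cdots > d_\ell$ and all $n_i \ge 1$ for the sequence consisting of $n_1$ copies of $d_1$, followed by $n_2$ copies of $d_2$, and so on up to $n_\ell$ copies of $d_\ell$, and let $n = \sum_{i=1}^{\ell} n_i$. Theorem (Rao's characterization). A degree sequence $(d_i^{n_i})_{i=1}^{\ell}$ is forcibly self-complementary if and only if (1) for all $i = 1, \dots, \lfloor \ell/2 \rfloor$, $$n_{\ell+1-i} = n_i \in \{2, 4\} \quad\text{and}\quad d_{\ell+1-i} = n - 1 - d_i = \sum_{j=1}^{i} n_j - \tfrac{1}{2} n_i;$$ and (2) if $\ell$ is odd, then $n_{(\ell+1)/2} \in \{1, 5\}$ and $d_{(\ell+1)/2} = \tfrac{1}{2}(n-1)$. -/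

import Mathlib

/-- The degree sequence of a finite simple graph: the degrees of all its vertices, listed in
non-increasing order. -/
noncomputable def degreeSequence {V : Type} [Fintype V] (G : SimpleGraph V) : List ℕ :=
  open Classical in (Finset.univ.val.map fun v : V => G.degree v).sort (· ≥ ·)

/-- `G` is isomorphic to its complement. -/
def IsSelfComplementary {V : Type} (G : SimpleGraph V) : Prop :=
  Nonempty (G ≃g Gᶜ)

/-- `τ` is a degree sequence, i.e. it is the degree sequence of some finite simple graph. -/
def IsDegreeSequence (τ : List ℕ) : Prop :=
  ∃ (V : Type) (_ : Fintype V) (G : SimpleGraph V), degreeSequence G = τ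

/-- All realizations of `τ` are self-complementary. -/
def IsForciblySelfComplementary (τ : List ℕ) : Prop :=
  ∀ (V : Type) [Fintype V] (G : SimpleGraph V), degreeSequence G = τ → IsSelfComplementary G

/-- The sequence `(d₁^{n₁}, …, d_ℓ^{n_ℓ})`: `n 1` copies of `d 1`, followed by `n 2` copies of
`d 2`, and so on up to `n ℓ` copies of `d ℓ`. Values at indices outside `1, …, ℓ` play no role. -/
def compactSequence (ℓ : ℕ) (d n : ℕ → ℕ) : List ℕ :=
  (List.range' 1 ℓ).flatMap fun i => List.replicate (n i) (d i)

/-!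
If every realization of a sequence is self-complementary, then in every realization exactly half of
the pairs consisting of a vertex of largest degree and a vertex of smallest degree are edges, so no
switch of two edges may change that number. If the two degrees differ by at least two, this rigidity
leaves only one possibility: the extreme vertices form a split graph, with the vertices of largest
degree as clique, both classes of size `2 * k` and every vertex having `k` neighbours in the
opposite class, and every other vertex is joined exactly to the clique. The degrees of the graph on
the other vertices are again forcibly self-complementary, so the extreme classes can be peeled off
in pairs.

The split graph amounts to a bipartite relation between two classes of size `2 * k` which is
`k`-regular on both sides. For `k ≤ 2` every such relation is isomorphic to its complement with the
two sides exchanged; for `k ≥ 3` one with twin columns but without twin rows is not.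

If the extreme degrees differ by at most one, a realization of chromatic number at most three with
a large independent set leaves only a single vertex, the pentagon and the path on four vertices.
-/

open Finset

section degreeIn

variable {V W : Type} {G G' : SimpleGraph V} {H : SimpleGraph W} {S : Finset V} {v w : V}

/-- The number of neighbours of `v` in `S`. Being free of decidability assumptions,
`degreeIn G v univ` also serves as the degree of `v` in statements about many graphs at once. -/
noncomputable def degreeIn (G : SimpleGraph V) (v : V) (S : Finset V) : ℕ :=
  open Classical in #{u ∈ S | G.Adj v u}

theorem degreeIn_eq_card_filter (G : SimpleGraph V) [DecidableRel G.Adj] (v : V) (S : Finset V) :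
    degreeIn G v S = #{u ∈ S | G.Adj v u} := by
  unfold degreeIn
  congr

theorem degreeIn_univ [Fintype V] (G : SimpleGraph V) [DecidableRel G.Adj] (v : V) :
    degreeIn G v univ = G.degree v := by
  rw [degreeIn_eq_card_filter, ← G.neighborFinset_eq_filter, G.card_neighborFinset_eq_degree]

theorem degreeIn_eq_sum (G : SimpleGraph V) [DecidableRel G.Adj] (v : V) (S : Finset V) :
    degreeIn G v S = ∑ u ∈ S, if G.Adj v u then 1 else 0 := by
  rw [degreeIn_eq_card_filter, card_filter]

theorem degreeIn_le_degreeIn (h : ∀ u ∈ S, G.Adj v u → G'.Adj w u) :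
    degreeIn G v S ≤ degreeIn G' w S := by
  classical exact card_le_card (monotone_filter_right S h)

theorem degreeIn_lt_degreeIn {u : V} (h : ∀ u ∈ S, G.Adj v u → G'.Adj w u) (hu : u ∈ S)
    (hwu : G'.Adj w u) (hvu : ¬ G.Adj v u) : degreeIn G v S < degreeIn G' w S := by
  classical
  simp only [degreeIn_eq_sum]
  refine sum_lt_sum (fun x hx => ?_) ⟨u, hu, ?_⟩
  · have := h x hx
    split_ifs <;> simp_all
  · simp [hwu, hvu]

theorem exists_adj_of_degreeIn_lt (h : degreeIn G v S < degreeIn G' w S) :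
    ∃ u ∈ S, G'.Adj w u ∧ ¬ G.Adj v u := by
  contrapose! h
  exact degreeIn_le_degreeIn h

theorem degreeIn_eq_zero_iff : degreeIn G v S = 0 ↔ ∀ u ∈ S, ¬ G.Adj v u := by
  classical rw [degreeIn_eq_card_filter, card_eq_zero, filter_eq_empty_iff]

theorem exists_adj_of_degreeIn_pos (h : 0 < degreeIn G v S) : ∃ u ∈ S, G.Adj v u := by
  contrapose! h
  exact (degreeIn_eq_zero_iff.2 h).le

theorem degreeIn_mono {T : Finset V} (h : S ⊆ T) : degreeIn G v S ≤ degreeIn G v T := by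
  classical exact card_le_card (filter_subset_filter _ h)

theorem degreeIn_add_degreeIn_compl [Fintype V] [DecidableEq V] (G : SimpleGraph V) (v : V)
    (S : Finset V) : degreeIn G v S + degreeIn G v Sᶜ = degreeIn G v univ := by
  classical
  simp only [degreeIn_eq_sum]
  exact sum_add_sum_compl S _

/-- The swap of `v` and `w` maps the neighbours of `v` in `S` to neighbours of `w`. -/
theorem degreeIn_le_of_mem (hv : v ∈ S) (h : ∀ y ∈ S, G.Adj v y → y ≠ w → G.Adj w y) :
    degreeIn G v S ≤ degreeIn G w S := by
  classical
  simp only [degreeIn_eq_card_filter]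
  refine card_le_card_of_injOn (Equiv.swap v w) (fun y hy => ?_) (Equiv.injective _).injOn
  rw [mem_coe, mem_filter] at hy ⊢
  obtain rfl | hyw := eq_or_ne y w
  · simpa using ⟨hv, hy.2.symm⟩
  · rw [Equiv.swap_apply_of_ne_of_ne hy.2.ne' hyw]
    exact ⟨hy.1, h y hy.1 hy.2 hyw⟩

theorem degreeIn_le_succ (h : ∀ y ∈ S, G.Adj v y → y ≠ w → G.Adj w y) :
    degreeIn G v S ≤ degreeIn G w S + 1 := by
  classical
  simp only [degreeIn_eq_card_filter]
  refine (card_le_card fun y hy => ?_).trans (card_insert_le w _)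
  rw [mem_filter] at hy
  rw [mem_insert, mem_filter]
  exact or_iff_not_imp_left.2 fun hyw => ⟨hy.1, h y hy.1 hy.2 hyw⟩

theorem degreeIn_compl_add_degreeIn (hv : v ∉ S) : degreeIn Gᶜ v S + degreeIn G v S = #S := by
  classical
  simp only [degreeIn_eq_card_filter]
  rw [← card_filter_add_card_filter_not (s := S) (fun u => Gᶜ.Adj v u)]
  congr 2
  refine filter_congr fun u hu => ?_
  have hvu : v ≠ u := (ne_of_mem_of_not_mem hu hv).symm
  simp [hvu]

theorem degreeIn_compl_le_degreeIn_compl (hv : v ∉ S) (hw : w ∉ S)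
    (h : degreeIn G w S ≤ degreeIn G v S) : degreeIn Gᶜ v S ≤ degreeIn Gᶜ w S := by
  have := degreeIn_compl_add_degreeIn (G := G) hv
  have := degreeIn_compl_add_degreeIn (G := G) hw
  omega

theorem degreeIn_compl_univ [Fintype V] (G : SimpleGraph V) (v : V) :
    degreeIn Gᶜ v univ + degreeIn G v univ + 1 = Fintype.card V := by
  classical
  rw [degreeIn_univ, degreeIn_univ, G.degree_compl]
  have := G.degree_lt_card_verts v
  omega

theorem sum_degreeIn_comm (G : SimpleGraph V) (A B : Finset V) :
    ∑ b ∈ B, degreeIn G b A = ∑ a ∈ A, degreeIn G a B := by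
  classical
  simp only [degreeIn_eq_sum]
  rw [sum_comm]
  simp only [G.adj_comm]

theorem degreeIn_map_iso (σ : G ≃g H) (v : V) (S : Finset V) :
    degreeIn H (σ v) (S.map σ.toEquiv.toEmbedding) = degreeIn G v S := by
  classical
  rw [degreeIn_eq_sum, degreeIn_eq_sum, sum_map]
  exact sum_congr rfl fun u _ => if_congr σ.map_adj_iff rfl rfl

theorem degreeIn_univ_iso [Fintype V] [Fintype W] (σ : G ≃g H) (v : V) :
    degreeIn H (σ v) univ = degreeIn G v univ := by
  rw [← degreeIn_map_iso σ, map_univ_equiv]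

end degreeIn

section switch

variable {V : Type} {G : SimpleGraph V} {a b c d : V}

/-- The graph obtained from `G` by exchanging the edges `ab` and `cd` for `ac` and `bd`. -/
def switch (G : SimpleGraph V) (a b c d : V) : SimpleGraph V :=
  G.deleteEdges {s(a, b), s(c, d)} ⊔ SimpleGraph.fromEdgeSet {s(a, c), s(b, d)}

theorem switch_adj {u v : V} : (switch G a b c d).Adj u v ↔
    (G.Adj u v ∧ s(u, v) ≠ s(a, b) ∧ s(u, v) ≠ s(c, d)) ∨
      (s(u, v) = s(a, c) ∨ s(u, v) = s(b, d)) ∧ u ≠ v := by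
  simp [switch]

theorem degreeIn_switch [Fintype V] (hab : G.Adj a b) (hcd : G.Adj c d) (hac : ¬ G.Adj a c)
    (hbd : ¬ G.Adj b d) (hac_ne : a ≠ c) (hbd_ne : b ≠ d) (v : V) :
    degreeIn (switch G a b c d) v univ = degreeIn G v univ := by
  classical
  obtain ⟨π, hπ⟩ : ∃ π : Equiv.Perm V, ∀ u, (switch G a b c d).Adj v (π u) ↔ G.Adj v u := by
    have := hab.symm
    have := hcd.symm
    have := G.adj_comm a c
    have := G.adj_comm b d
    have := hab.ne
    have := hcd.ne
    have had : a ≠ d := fun h => hac (h ▸ hcd.symm)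
    have hbc : b ≠ c := fun h => hac (h ▸ hab)
    by_cases hv : v = a ∨ v = d
    · refine ⟨Equiv.swap b c, fun u => ?_⟩
      simp only [switch_adj, Equiv.swap_apply_def, Sym2.eq_iff]
      grind [G.irrefl]
    by_cases hv' : v = b ∨ v = c
    · refine ⟨Equiv.swap a d, fun u => ?_⟩
      simp only [switch_adj, Equiv.swap_apply_def, Sym2.eq_iff]
      grind
    · refine ⟨1, fun u => ?_⟩
      simp only [switch_adj, Equiv.Perm.one_apply, Sym2.eq_iff]
      grind
  simp only [degreeIn_eq_sum, ← hπ]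
  exact (Equiv.sum_comp π fun u => if (switch G a b c d).Adj v u then 1 else 0).symm

end switch

section RigidPair

variable {V : Type} {G : SimpleGraph V} {A B : Finset V} {a b c x y : V}

theorem sum_degreeIn_switch_lt (hab : Disjoint A B) (ha : a ∈ A) (hb : b ∈ B) (hx : x ∉ B)
    (hy : y ∉ A) (hadj : G.Adj a b) :
    ∑ v ∈ A, degreeIn (switch G a b x y) v B < ∑ v ∈ A, degreeIn G v B := by
  have hle : ∀ v ∈ A, ∀ u ∈ B, (switch G a b x y).Adj v u → G.Adj v u := by
    intro v hv u hu
    have := disjoint_left.1 hab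
    simp only [switch_adj, Sym2.eq_iff]
    grind
  refine sum_lt_sum (fun v hv => degreeIn_le_degreeIn (hle v hv)) ⟨a, ha, ?_⟩
  refine degreeIn_lt_degreeIn (hle a ha) hb hadj ?_
  have := disjoint_left.1 hab
  simp only [switch_adj, Sym2.eq_iff]
  grind

theorem lt_sum_degreeIn_switch (hab : Disjoint A B) (ha : a ∈ A) (hb : b ∈ B) (hx : x ∉ B)
    (hy : y ∉ A) (hadj : ¬ G.Adj a b) :
    ∑ v ∈ A, degreeIn G v B < ∑ v ∈ A, degreeIn (switch G a x b y) v B := by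
  have hle : ∀ v ∈ A, ∀ u ∈ B, G.Adj v u → (switch G a x b y).Adj v u := by
    intro v hv u hu
    have := disjoint_left.1 hab
    simp only [switch_adj, Sym2.eq_iff]
    grind
  refine sum_lt_sum (fun v hv => degreeIn_le_degreeIn (hle v hv)) ⟨a, ha, ?_⟩
  refine degreeIn_lt_degreeIn (hle a ha) hb ?_ hadj
  have := disjoint_left.1 hab
  simp only [switch_adj, Sym2.eq_iff]
  grind

variable [Fintype V]

/-- The set `A` of the vertices of largest degree and the set `B` of those of smallest degree are
separated by at least two, and no edge switch of `G` changes the number of edges between them in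
the two ways described by `not_adj` and `adj`. -/
structure IsRigidPair (G : SimpleGraph V) (A B : Finset V) : Prop where
  disjoint : Disjoint A B
  lt_top : ∀ a ∈ A, ∀ v ∉ A, degreeIn G v univ < degreeIn G a univ
  bot_lt : ∀ b ∈ B, ∀ v ∉ B, degreeIn G b univ < degreeIn G v univ
  gap : ∀ a ∈ A, ∀ b ∈ B, degreeIn G b univ + 2 ≤ degreeIn G a univ
  not_adj : ∀ a ∈ A, ∀ b ∈ B, ∀ x ∉ B, ∀ y ∉ A, G.Adj a b → a ≠ x → ¬ G.Adj a x → b ≠ y →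
    ¬ G.Adj b y → ¬ G.Adj x y
  adj : ∀ a ∈ A, ∀ b ∈ B, ∀ x ∉ B, ∀ y ∉ A, ¬ G.Adj a b → G.Adj a x → G.Adj b y → x ≠ y →
    G.Adj x y

theorem isRigidPair_of_forall_sum_eq (hAB : Disjoint A B)
    (lt_top : ∀ a ∈ A, ∀ v ∉ A, degreeIn G v univ < degreeIn G a univ)
    (bot_lt : ∀ b ∈ B, ∀ v ∉ B, degreeIn G b univ < degreeIn G v univ)
    (gap : ∀ a ∈ A, ∀ b ∈ B, degreeIn G b univ + 2 ≤ degreeIn G a univ)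
    (h : ∀ G' : SimpleGraph V, (∀ v, degreeIn G' v univ = degreeIn G v univ) →
      ∑ a ∈ A, degreeIn G' a B = ∑ a ∈ A, degreeIn G a B) :
    IsRigidPair G A B where
  disjoint := hAB
  lt_top := lt_top
  bot_lt := bot_lt
  gap := gap
  not_adj a ha b hb x hx y hy hab hax hnax hby hnby hxy :=
    (sum_degreeIn_switch_lt hAB ha hb hx hy hab).ne
      (h _ (degreeIn_switch hab hxy hnax hnby hax hby))
  adj a ha b hb x hx y hy hnab hax hby hxy := by
    by_contra hnxy
    exact (lt_sum_degreeIn_switch hAB ha hb hx hy hnab).ne'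
      (h _ (degreeIn_switch hax hby hnab hnxy (disjoint_iff_ne.1 hAB a ha b hb) hxy))

namespace IsRigidPair

theorem compl (h : IsRigidPair G A B) : IsRigidPair Gᶜ B A where
  disjoint := h.disjoint.symm
  lt_top b hb v hv := by
    have := h.bot_lt b hb v hv
    have := degreeIn_compl_univ G v
    have := degreeIn_compl_univ G b
    omega
  bot_lt a ha v hv := by
    have := h.lt_top a ha v hv
    have := degreeIn_compl_univ G v
    have := degreeIn_compl_univ G a
    omega
  gap b hb a ha := by
    have := h.gap a ha b hb
    have := degreeIn_compl_univ G a
    have := degreeIn_compl_univ G b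
    omega
  not_adj b hb a ha y hy x hx := by
    have := h.adj a ha b hb x hx y hy
    simp only [SimpleGraph.compl_adj]
    grind [G.adj_comm]
  adj b hb a ha y hy x hx := by
    have := h.not_adj a ha b hb x hx y hy
    have := disjoint_iff_ne.1 h.disjoint a ha b hb
    simp only [SimpleGraph.compl_adj]
    grind [G.adj_comm]

/-- Every neighbour of `x` outside `A` is adjacent to `c`, so `x`, having larger degree than `c`,
must make up for it inside `A`. -/
theorem degreeIn_top_lt (h : IsRigidPair G A B) (ha : a ∈ A) (hc : c ∈ B) (hac : G.Adj a c)
    (hx : x ∉ B) (hax : a ≠ x) (hnax : ¬ G.Adj a x) : degreeIn G c A < degreeIn G x A := by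
  classical
  have hsub : ∀ y ∈ Aᶜ, G.Adj x y → y ≠ c → G.Adj c y := by
    intro y hy hxy hyc
    by_contra hcy
    exact h.not_adj a ha c hc x hx y (mem_compl.1 hy) hac hax hnax hyc.symm hcy hxy
  have hxs := degreeIn_add_degreeIn_compl G x A
  have hcs := degreeIn_add_degreeIn_compl G c A
  by_cases hxA : x ∈ A
  · have := h.gap x hxA c hc
    have := degreeIn_le_succ hsub
    omega
  · have := h.bot_lt c hc x hx
    have := degreeIn_le_of_mem (mem_compl.2 hxA) hsub
    omega

theorem adj_of_not_adj_top (h : IsRigidPair G A B) (ha : a ∈ A) (hb : b ∈ B)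
    (hmin : ∀ c ∈ B, degreeIn G b A ≤ degreeIn G c A) (hab : 0 < degreeIn G a B) (hx : x ∉ B)
    (hy : y ∉ A) (hax : a ≠ x) (hnax : ¬ G.Adj a x) (hby : G.Adj b y) (hxy : x ≠ y) :
    G.Adj x y := by
  obtain ⟨c, hc, hac⟩ := exists_adj_of_degreeIn_pos hab
  obtain ⟨a', ha', hxa', hba'⟩ : ∃ a' ∈ A, G.Adj x a' ∧ ¬ G.Adj b a' :=
    exists_adj_of_degreeIn_lt ((hmin c hc).trans_lt (h.degreeIn_top_lt ha hc hac hx hax hnax))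
  exact h.adj a' ha' b hb x hx y hy (fun h' => hba' h'.symm) hxa'.symm hby hxy

theorem eq_of_not_adj_top_of_adj_bot (h : IsRigidPair G A B) (ha : a ∈ A) (hb : b ∈ B)
    (hmax : ∀ c ∈ A, degreeIn G c B ≤ degreeIn G a B)
    (hmin : ∀ c ∈ B, degreeIn G b A ≤ degreeIn G c A) (hab : 0 < degreeIn G a B)
    (hba : 0 < degreeIn Gᶜ b A) (hx : x ∉ B) (hy : y ∉ A) (hax : a ≠ x) (hnax : ¬ G.Adj a x)
    (hby : G.Adj b y) : x = y := by
  by_contra hxy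
  have hadj : G.Adj x y := h.adj_of_not_adj_top ha hb hmin hab hx hy hax hnax hby hxy
  have hmax' : ∀ c ∈ A, degreeIn Gᶜ a B ≤ degreeIn Gᶜ c B := fun c hc =>
    degreeIn_compl_le_degreeIn_compl (disjoint_left.1 h.disjoint ha)
      (disjoint_left.1 h.disjoint hc) (hmax c hc)
  have hadj' : Gᶜ.Adj y x := h.compl.adj_of_not_adj_top hb ha hmax' hba hy hx hby.ne
    (fun h' => h'.2 hby) ⟨hax, hnax⟩ (Ne.symm hxy)
  exact hadj'.2 hadj.symm

theorem not_adj_bot_of_not_adj_top (h : IsRigidPair G A B) (ha : a ∈ A) (hb : b ∈ B)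
    (hmax : ∀ c ∈ A, degreeIn G c B ≤ degreeIn G a B)
    (hmin : ∀ c ∈ B, degreeIn G b A ≤ degreeIn G c A) (hab : 0 < degreeIn G a B)
    (hba : 0 < degreeIn Gᶜ b A) (hx : x ∉ B) (hy : y ∉ A) (hax : a ≠ x) (hnax : ¬ G.Adj a x) :
    ¬ G.Adj b y := by
  intro hby
  obtain rfl := h.eq_of_not_adj_top_of_adj_bot ha hb hmax hmin hab hba hx hy hax hnax hby
  have notMem_A : ∀ c ∈ B, c ∉ A := fun c hc => disjoint_right.1 h.disjoint hc
  have notMem_B : ∀ c ∈ A, c ∉ B := fun c hc => disjoint_left.1 h.disjoint hc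
  obtain ⟨c, hc, hac, hxc⟩ : ∃ c ∈ B, G.Adj a c ∧ ¬ G.Adj x c := by
    obtain ⟨a', ha', hba'⟩ := exists_adj_of_degreeIn_pos hba
    refine exists_adj_of_degreeIn_lt ?_
    have hlt : degreeIn Gᶜ a' B < degreeIn Gᶜ x B :=
      h.compl.degreeIn_top_lt hb ha' hba' hy hby.ne fun h' => h'.2 hby
    refine (lt_of_not_ge fun hle => hlt.not_ge ?_).trans_le (hmax a' ha')
    exact degreeIn_compl_le_degreeIn_compl hx (notMem_B a' ha') hle
  have hcx : c ≠ x := (ne_of_mem_of_not_mem hc hx)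
  have hbc : G.Adj b c := by
    by_contra hbc
    have hcb : c ≠ b := by
      rintro rfl
      exact hxc hby.symm
    exact h.not_adj a ha c hc x hx b (notMem_A b hb) hac hax hnax hcb (fun h' => hbc h'.symm)
      hby.symm
  exact hxc (h.adj_of_not_adj_top ha hb hmin hab hx (notMem_A c hc) hax hnax hbc hcx.symm)

theorem degreeIn_bot_le (h : IsRigidPair G A B) {k : ℕ} (hk : 1 ≤ k) (hA : #A = 2 * k)
    (hB : #B = 2 * k) (ha : a ∈ A) (hb : b ∈ B)
    (hmax : ∀ c ∈ A, degreeIn G c B ≤ degreeIn G a B)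
    (hmin : ∀ c ∈ B, degreeIn G b A ≤ degreeIn G c A)
    (hdeg : degreeIn G a univ + degreeIn G b univ + 1 = Fintype.card V)
    (hab : k ≤ degreeIn G a B) (hba : degreeIn G b A ≤ k) : degreeIn G b univ ≤ k := by
  classical
  have haB := degreeIn_compl_add_degreeIn (G := G) (disjoint_left.1 h.disjoint ha)
  have hbA := degreeIn_compl_add_degreeIn (G := G) (disjoint_right.1 h.disjoint hb)
  by_cases htop : ∀ x ∈ Bᶜ, ¬ Gᶜ.Adj a x
  · have haBc := degreeIn_eq_zero_iff.2 htop
    have ha_split := degreeIn_add_degreeIn_compl Gᶜ a B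
    have ha_compl := degreeIn_compl_univ G a
    omega
  · push Not at htop
    obtain ⟨x, hx, hax, hnax⟩ := htop
    have hbAc : degreeIn G b Aᶜ = 0 := degreeIn_eq_zero_iff.2 fun y hy =>
      h.not_adj_bot_of_not_adj_top ha hb hmax hmin (by omega) (by omega) (mem_compl.1 hx)
        (mem_compl.1 hy) hax hnax
    have hb_split := degreeIn_add_degreeIn_compl G b A
    omega

theorem degreeIn_bot_eq (h : IsRigidPair G A B) {k : ℕ} (hk : 1 ≤ k) (hA : #A = 2 * k)
    (hB : #B = 2 * k) (hdeg : ∀ a ∈ A, ∀ b ∈ B,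
      degreeIn G a univ + degreeIn G b univ + 1 = Fintype.card V)
    (hsum : ∑ a ∈ A, degreeIn G a B = 2 * k * k) (hb : b ∈ B) : degreeIn G b univ = k := by
  obtain ⟨a, ha, hmax⟩ := exists_max_image A (degreeIn G · B) (card_pos.1 (by omega))
  obtain ⟨b', hb', hmin⟩ := exists_min_image B (degreeIn G · A) ⟨b, hb⟩
  have hbb' : degreeIn G b' univ = degreeIn G b univ := by
    have := hdeg a ha b hb
    have := hdeg a ha b' hb'
    omega
  refine le_antisymm ?_ ?_
  · rw [← hbb']
    refine h.degreeIn_bot_le hk hA hB ha hb' hmax hmin (hdeg a ha b' hb') ?_ ?_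
    · have hle := sum_le_card_nsmul A _ _ hmax
      rw [hsum, hA, smul_eq_mul] at hle
      exact Nat.le_of_mul_le_mul_left hle (by omega)
    · have hle := card_nsmul_le_sum B _ _ hmin
      rw [sum_degreeIn_comm, hsum, hB, smul_eq_mul] at hle
      exact Nat.le_of_mul_le_mul_left hle (by omega)
  · have hle : ∑ c ∈ B, degreeIn G c A ≤ #B • degreeIn G b univ := by
      refine sum_le_card_nsmul B _ _ fun c hc => ?_
      have := hdeg a ha b hb
      have := hdeg a ha c hc
      have := degreeIn_mono (G := G) (v := c) (subset_univ A)
      omega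
    rw [sum_degreeIn_comm, hsum, hB, smul_eq_mul] at hle
    exact Nat.le_of_mul_le_mul_left hle (by omega)

end IsRigidPair

end RigidPair

section SelfComplementary

variable {V W : Type} {G : SimpleGraph V} {H : SimpleGraph W}

theorem isSelfComplementary_of_injective [Finite V] {g : V → V} (hg : g.Injective)
    (h : ∀ u v, u ≠ v → (G.Adj (g u) (g v) ↔ ¬ G.Adj u v)) : IsSelfComplementary G := by
  refine ⟨Equiv.ofBijective g hg.bijective_of_finite, fun {u v} => ?_⟩
  obtain rfl | huv := eq_or_ne u v
  · simp
  · simp [h u v huv, hg.ne huv]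

theorem IsSelfComplementary.of_iso (e : G ≃g H) (h : IsSelfComplementary G) :
    IsSelfComplementary H :=
  h.map fun σ => (e.symm.trans σ).trans
    ⟨e.toEquiv, and_congr e.injective.ne_iff (not_congr e.map_adj_iff)⟩

theorem IsSelfComplementary.card_le_of_coloring {α : Type} [Fintype α]
    (h : IsSelfComplementary G) (C : G.Coloring α) {s : Finset V} (hs : G.IsIndepSet s) :
    #s ≤ Fintype.card α := by
  obtain ⟨σ⟩ := h
  have hclique : Gᶜ.IsClique s := by rwa [SimpleGraph.isClique_compl]
  exact hclique.card_le_of_coloring (C.comp σ.symm.toHom)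

theorem two_mul_sum_degreeIn_eq (σ : G ≃g Gᶜ) {A B : Finset V} (hdisj : Disjoint A B)
    (hAB : A.map σ.toEquiv.toEmbedding = B) (hBA : B.map σ.toEquiv.toEmbedding = A) :
    2 * ∑ a ∈ A, degreeIn G a B = #A * #B := by
  have hcompl : ∑ a ∈ A, degreeIn Gᶜ a B = ∑ a ∈ A, degreeIn G a B := by
    rw [← sum_degreeIn_comm Gᶜ]
    conv_lhs => rw [← hAB, sum_map]
    exact sum_congr rfl fun a _ => hBA ▸ degreeIn_map_iso σ a B
  rw [two_mul]
  nth_rewrite 1 [← hcompl]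
  rw [← sum_add_distrib,
    sum_congr rfl fun a ha => degreeIn_compl_add_degreeIn (disjoint_left.1 hdisj ha), sum_const,
    smul_eq_mul]

variable [Fintype V] [Fintype W]

theorem degreeIn_apply_add_degreeIn (σ : G ≃g Gᶜ) (v : V) :
    degreeIn G (σ v) univ + degreeIn G v univ + 1 = Fintype.card V := by
  have := degreeIn_univ_iso σ v
  have := degreeIn_compl_univ G (σ v)
  omega

/-- The degrees of the vertices of `G`; unlike `degreeSequence` this needs no sorting. -/
noncomputable def degreeMultiset (G : SimpleGraph V) : Multiset ℕ :=
  univ.val.map fun v => degreeIn G v univ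

/-- Every graph whose vertex degrees are the entries of `D` is self-complementary. -/
def ForcesSelfComplementary (D : Multiset ℕ) : Prop :=
  ∀ (V : Type) [Fintype V] (G : SimpleGraph V), degreeMultiset G = D → IsSelfComplementary G

/-- The set of the vertices of degree `p`. -/
noncomputable def degreeClass (G : SimpleGraph V) (p : ℕ) : Finset V :=
  {v | degreeIn G v univ = p}

theorem mem_degreeClass {p : ℕ} {v : V} : v ∈ degreeClass G p ↔ degreeIn G v univ = p := by
  simp [degreeClass]

theorem disjoint_degreeClass {p q : ℕ} (hpq : p ≠ q) :
    Disjoint (degreeClass G p) (degreeClass G q) := by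
  rw [disjoint_left]
  simp only [mem_degreeClass]
  grind

theorem card_degreeMultiset (G : SimpleGraph V) : (degreeMultiset G).card = Fintype.card V := by
  simp [degreeMultiset]

theorem mem_degreeMultiset {x : ℕ} : x ∈ degreeMultiset G ↔ ∃ v, degreeIn G v univ = x := by
  simp [degreeMultiset]

theorem count_degreeMultiset (G : SimpleGraph V) (p : ℕ) :
    (degreeMultiset G).count p = #(degreeClass G p) := by
  rw [degreeMultiset, Multiset.count_map, degreeClass, card_def, filter_val]
  simp only [eq_comm]

theorem degreeMultiset_iso (e : G ≃g H) : degreeMultiset G = degreeMultiset H := by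
  have := congrArg val (map_univ_equiv e.toEquiv)
  rw [degreeMultiset, degreeMultiset, ← this]
  simp only [map_val, Multiset.map_map, Function.comp_def]
  exact Multiset.map_congr rfl fun v _ => (degreeIn_univ_iso e v).symm

theorem map_degreeClass (σ : G ≃g Gᶜ) {p q : ℕ} (h : p + q + 1 = Fintype.card V) :
    (degreeClass G p).map σ.toEquiv.toEmbedding = degreeClass G q := by
  ext v
  have := degreeIn_apply_add_degreeIn σ (σ.symm v)
  rw [σ.apply_symm_apply] at this
  rw [mem_map_equiv, mem_degreeClass, mem_degreeClass]
  change degreeIn G (σ.symm v) univ = p ↔ _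
  omega

end SelfComplementary

section Sum

variable {α β W : Type} [Fintype α] [Fintype β] [Fintype W]

theorem degreeIn_univ_sum {G : SimpleGraph (α ⊕ β ⊕ W)} {v : α ⊕ β ⊕ W} {p : α → Prop}
    {q : β → Prop} {r : W → Prop} [DecidablePred p] [DecidablePred q] [DecidablePred r]
    (hp : ∀ a, G.Adj v (.inl a) ↔ p a) (hq : ∀ b, G.Adj v (.inr (.inl b)) ↔ q b)
    (hr : ∀ w, G.Adj v (.inr (.inr w)) ↔ r w) :
    degreeIn G v univ = #{a | p a} + #{b | q b} + #{w | r w} := by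
  classical
  simp only [degreeIn_eq_sum, Fintype.sum_sum_type, card_filter, add_assoc, hp, hq, hr]

theorem degreeMultiset_sum (G : SimpleGraph (α ⊕ β ⊕ W)) :
    degreeMultiset G = (univ.val.map fun a => degreeIn G (.inl a) univ) +
      (univ.val.map fun b => degreeIn G (.inr (.inl b)) univ) +
      univ.val.map fun w => degreeIn G (.inr (.inr w)) univ := by
  simp [degreeMultiset, ← univ_disjSum_univ, Multiset.disjSum, add_assoc]

end Sum

section matchedCrown

variable (ι W : Type)

/-- Three independent sets `ι × Bool`, `ι × Bool` and `W`, where the first two span a complete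
bipartite graph minus a perfect matching, `W` is joined to the first, and the second
carries the perfect matching `(i, false) (i, true)`. The chromatic number is at most three although
there is a large independent set, so the graph is not self-complementary. -/
def matchedCrown : SimpleGraph ((ι × Bool) ⊕ (ι × Bool) ⊕ W) where
  Adj
    | .inl i, .inr (.inl j) | .inr (.inl j), .inl i => i ≠ j
    | .inr (.inl i), .inr (.inl j) => i.1 = j.1 ∧ i.2 ≠ j.2
    | .inl _, .inr (.inr _) | .inr (.inr _), .inl _ => True
    | _, _ => False
  symm := ⟨by rintro (_ | _ | _) (_ | _ | _) <;> simp +contextual [eq_comm]⟩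
  loopless := ⟨by rintro (_ | _ | _) <;> simp⟩

variable {ι W}

theorem degreeIn_matchedCrown_inl [Fintype ι] [Fintype W] (i : ι × Bool) :
    degreeIn (matchedCrown ι W) (.inl i) univ = 2 * Fintype.card ι - 1 + Fintype.card W := by
  classical
  rw [degreeIn_univ_sum (p := fun _ => False) (q := fun j => i ≠ j) (r := fun _ => True)
    (fun _ => Iff.rfl) (fun _ => Iff.rfl) (fun _ => Iff.rfl), filter_ne]
  simp [mul_comm]

theorem degreeIn_matchedCrown_inr_inl [Fintype ι] [Fintype W] (i : ι × Bool) :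
    degreeIn (matchedCrown ι W) (.inr (.inl i)) univ = 2 * Fintype.card ι := by
  classical
  have hmatch : ({j | i.1 = j.1 ∧ i.2 ≠ j.2} : Finset (ι × Bool)) = {(i.1, !i.2)} := by
    ext ⟨j, ε⟩
    simp only [mem_filter_univ, mem_singleton, Prod.mk.injEq, Bool.eq_not, eq_comm, ne_eq]
  have : 0 < Fintype.card ι := Fintype.card_pos_iff.2 ⟨i.1⟩
  rw [degreeIn_univ_sum (p := fun j => j ≠ i) (q := fun j => i.1 = j.1 ∧ i.2 ≠ j.2)
    (r := fun _ => False) (fun _ => Iff.rfl) (fun _ => Iff.rfl) (fun _ => Iff.rfl), filter_ne',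
    hmatch, card_erase_of_mem (mem_univ _), card_univ, Fintype.card_prod, Fintype.card_bool,
    card_singleton, filter_false, card_empty]
  omega

theorem degreeIn_matchedCrown_inr_inr [Fintype ι] [Fintype W] (w : W) :
    degreeIn (matchedCrown ι W) (.inr (.inr w)) univ = 2 * Fintype.card ι := by
  classical
  rw [degreeIn_univ_sum (p := fun _ => True) (q := fun _ => False) (r := fun _ => False)
    (fun _ => Iff.rfl) (fun _ => Iff.rfl) (fun _ => Iff.rfl)]
  simp [mul_comm]

theorem degreeMultiset_matchedCrown [Fintype ι] [Fintype W] :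
    degreeMultiset (matchedCrown ι W) =
      Multiset.replicate (2 * Fintype.card ι) (2 * Fintype.card ι - 1 + Fintype.card W) +
        Multiset.replicate (2 * Fintype.card ι + Fintype.card W) (2 * Fintype.card ι) := by
  simp [degreeMultiset_sum, degreeIn_matchedCrown_inl, degreeIn_matchedCrown_inr_inl,
    degreeIn_matchedCrown_inr_inr, Multiset.replicate_add, mul_comm, add_assoc]

theorem not_isSelfComplementary_matchedCrown [Fintype ι] (hι : 2 ≤ Fintype.card ι) :
    ¬ IsSelfComplementary (matchedCrown ι W) := by
  intro h
  let C : (matchedCrown ι W).Coloring (Option Bool) := SimpleGraph.Coloring.mk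
    (fun
      | .inl _ => none
      | .inr (.inl i) => some i.2
      | .inr (.inr _) => some false)
    (by rintro (_ | _ | _) (_ | _ | _) <;> simp [matchedCrown])
  let s : Finset ((ι × Bool) ⊕ (ι × Bool) ⊕ W) := univ.map Function.Embedding.inl
  have hs : (matchedCrown ι W).IsIndepSet s := by
    rintro (_ | _ | _) hx (_ | _ | _) hy <;> simp_all [s, matchedCrown]
  have := h.card_le_of_coloring C hs
  simp only [s, card_map, card_univ, Fintype.card_prod, Fintype.card_bool, Fintype.card_option]
    at this
  omega

end matchedCrown

section ExtremeDegrees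

variable {V : Type} [Fintype V] {G : SimpleGraph V} {k p q : ℕ}

theorem IsSelfComplementary.add_add_one_eq_card (h : IsSelfComplementary G)
    (hp : p ∈ degreeMultiset G) (hq : q ∈ degreeMultiset G)
    (hle : ∀ v, degreeIn G v univ ≤ p) (hge : ∀ v, q ≤ degreeIn G v univ) :
    p + q + 1 = Fintype.card V := by
  obtain ⟨σ⟩ := h
  obtain ⟨a, rfl⟩ := mem_degreeMultiset.1 hp
  obtain ⟨b, rfl⟩ := mem_degreeMultiset.1 hq
  have := degreeIn_apply_add_degreeIn σ a
  have := hge (σ a)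
  have := degreeIn_apply_add_degreeIn σ b
  have := hle (σ b)
  omega

theorem IsSelfComplementary.card_degreeClass_eq (h : IsSelfComplementary G)
    (hpq : p + q + 1 = Fintype.card V) : #(degreeClass G q) = #(degreeClass G p) := by
  obtain ⟨σ⟩ := h
  rw [← map_degreeClass σ hpq, card_map]

theorem IsSelfComplementary.two_mul_sum_degreeIn_degreeClass (h : IsSelfComplementary G)
    (hpq : p + q + 1 = Fintype.card V) (hne : p ≠ q) :
    2 * ∑ a ∈ degreeClass G p, degreeIn G a (degreeClass G q) =
      #(degreeClass G p) * #(degreeClass G p) := by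
  have hcard := h.card_degreeClass_eq hpq
  obtain ⟨σ⟩ := h
  rw [two_mul_sum_degreeIn_eq σ (disjoint_degreeClass hne) (map_degreeClass σ hpq)
    (map_degreeClass σ (by omega)), hcard]

theorem degreeMultiset_congr {G' : SimpleGraph V}
    (h : ∀ v, degreeIn G' v univ = degreeIn G v univ) : degreeMultiset G' = degreeMultiset G :=
  Multiset.map_congr rfl fun v _ => h v

theorem degreeClass_congr {G' : SimpleGraph V}
    (h : ∀ v, degreeIn G' v univ = degreeIn G v univ) : degreeClass G' p = degreeClass G p := by
  simp only [degreeClass, h]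

/-- By self-complementarity half of the pairs between the two extreme classes are edges, in every
realization, so no switch changes their number. -/
theorem ForcesSelfComplementary.isRigidPair (hG : ForcesSelfComplementary (degreeMultiset G))
    (hle : ∀ v, degreeIn G v univ ≤ p) (hge : ∀ v, q ≤ degreeIn G v univ)
    (hpq : p + q + 1 = Fintype.card V) (hgap : q + 2 ≤ p) :
    IsRigidPair G (degreeClass G p) (degreeClass G q) := by
  refine isRigidPair_of_forall_sum_eq (disjoint_degreeClass (by omega)) ?_ ?_ ?_ ?_
  · simp only [mem_degreeClass]
    rintro a rfl v hv
    exact (hle v).lt_of_ne hv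
  · simp only [mem_degreeClass]
    rintro b rfl v hv
    exact (hge v).lt_of_ne' hv
  · simp only [mem_degreeClass]
    rintro a rfl b rfl
    exact hgap
  · intro G' hG'
    have hsum := (hG V G rfl).two_mul_sum_degreeIn_degreeClass hpq (by omega)
    have hsum' := (hG V G' (degreeMultiset_congr hG')).two_mul_sum_degreeIn_degreeClass hpq
      (by omega)
    simp only [degreeClass_congr hG'] at hsum'
    omega

theorem degreeMultiset_eq_replicate_add_replicate (hpq : p ≠ q)
    (h : ∀ v, degreeIn G v univ = p ∨ degreeIn G v univ = q) :
    degreeMultiset G = Multiset.replicate #(degreeClass G p) p +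
      Multiset.replicate #(degreeClass G q) q := by
  simp only [← count_degreeMultiset]
  rw [← Multiset.filter_eq', ← Multiset.filter_eq']
  conv_lhs => rw [← Multiset.filter_add_not (· = p) (degreeMultiset G)]
  congr 1
  refine Multiset.filter_congr fun x hx => ?_
  obtain ⟨v, rfl⟩ := mem_degreeMultiset.1 hx
  grind

theorem ForcesSelfComplementary.eq_of_gap_eq_one
    (hG : ForcesSelfComplementary (degreeMultiset G))
    (h : ∀ v, degreeIn G v univ = q + 1 ∨ degreeIn G v univ = q)
    (hcard : 2 * q + 2 = Fintype.card V) (hp : #(degreeClass G (q + 1)) = 2 * k)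
    (hq : #(degreeClass G q) = 2 * k) : q = k := by
  have hdeg := degreeMultiset_eq_replicate_add_replicate (Nat.succ_ne_self q) h
  have hV : 4 * k = Fintype.card V := by
    rw [← card_degreeMultiset G, hdeg, hp, hq]
    simp only [Multiset.card_add, Multiset.card_replicate]
    omega
  have : k < 2 := by
    by_contra! hk2
    refine not_isSelfComplementary_matchedCrown (ι := Fin k) (W := Empty) (by simpa) (hG _ _ ?_)
    rw [hdeg, degreeMultiset_matchedCrown, hp, hq, add_comm]
    simp only [Fintype.card_fin, Fintype.card_empty, add_zero]
    congr 2 <;> omega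
  omega

theorem ForcesSelfComplementary.exists_extreme_degrees
    (hG : ForcesSelfComplementary (degreeMultiset G)) (hp : p ∈ degreeMultiset G)
    (hq : q ∈ degreeMultiset G) (hle : ∀ v, degreeIn G v univ ≤ p)
    (hge : ∀ v, q ≤ degreeIn G v univ) (hlt : q < p) :
    ∃ k, 1 ≤ k ∧ #(degreeClass G p) = 2 * k ∧ #(degreeClass G q) = 2 * k ∧ q = k ∧
      p + k + 1 = Fintype.card V := by
  have hpq := (hG V G rfl).add_add_one_eq_card hp hq hle hge
  have hsum := (hG V G rfl).two_mul_sum_degreeIn_degreeClass hpq hlt.ne'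
  have hcard := (hG V G rfl).card_degreeClass_eq hpq
  obtain ⟨k, hk⟩ : Even #(degreeClass G p) := by
    have : Even (#(degreeClass G p) * #(degreeClass G p)) := hsum ▸ even_two_mul _
    simpa [Nat.even_mul] using this
  obtain ⟨a, ha⟩ := mem_degreeMultiset.1 hp
  obtain ⟨b, hb⟩ := mem_degreeMultiset.1 hq
  have hpos : 0 < #(degreeClass G p) := card_pos.2 ⟨a, mem_degreeClass.2 ha⟩
  suffices q = k by exact ⟨k, by omega, by omega, by omega, this, by omega⟩
  obtain hgap | rfl : q + 2 ≤ p ∨ p = q + 1 := by omega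
  · rw [← hb]
    refine (hG.isRigidPair hle hge hpq hgap).degreeIn_bot_eq (by omega) (by omega) (by omega) ?_ ?_
      (mem_degreeClass.2 hb)
    · simp only [mem_degreeClass]
      rintro a rfl b rfl
      exact hpq
    · rw [hk] at hsum
      linarith
  · refine hG.eq_of_gap_eq_one (fun v => ?_) (by omega) (by omega) (by omega)
    have := hle v
    have := hge v
    omega

end ExtremeDegrees

section splitCompose

variable {α β W : Type} {R : α → β → Prop} {H : SimpleGraph W} {k : ℕ}

/-- The composition of the split graph with clique `α`, independent set `β` and cross adjacency `R`
with the graph `H`: every vertex of `H` is joined to the clique only. -/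
def splitCompose (R : α → β → Prop) (H : SimpleGraph W) : SimpleGraph (α ⊕ β ⊕ W) where
  Adj
    | .inl a, .inl a' => a ≠ a'
    | .inl a, .inr (.inl b) | .inr (.inl b), .inl a => R a b
    | .inl _, .inr (.inr _) | .inr (.inr _), .inl _ => True
    | .inr (.inr w), .inr (.inr w') => H.Adj w w'
    | _, _ => False
  symm := ⟨by rintro (_ | _ | _) (_ | _ | _) <;> simp +contextual [eq_comm, H.adj_comm]⟩
  loopless := ⟨by rintro (_ | _ | _) <;> simp⟩

/-- The split graph with clique `α`, independent set `β` and cross adjacency `R` has an isomorphism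
onto its complement that exchanges `α` and `β`. -/
def IsSelfComplementaryRel (R : α → β → Prop) : Prop :=
  ∃ (s : α ≃ β) (t : β ≃ α), ∀ a b, R (t b) (s a) ↔ ¬ R a b

theorem IsSelfComplementaryRel.exists_equal_rows (hR : IsSelfComplementaryRel R) {b b' : β}
    (hne : b ≠ b') (hbb' : ∀ a, R a b ↔ R a b') : ∃ a a', a ≠ a' ∧ ∀ c, R a c ↔ R a' c := by
  obtain ⟨s, t, h⟩ := hR
  refine ⟨t b, t b', t.injective.ne hne, fun c => ?_⟩
  obtain ⟨a, rfl⟩ := s.surjective c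
  rw [h, h, hbb']

theorem IsSelfComplementaryRel.splitCompose [Finite α] [Finite β] [Finite W]
    (hR : IsSelfComplementaryRel R) (hH : IsSelfComplementary H) :
    IsSelfComplementary (splitCompose R H) := by
  obtain ⟨s, t, hst⟩ := hR
  obtain ⟨σ⟩ := hH
  refine isSelfComplementary_of_injective
    (g := Sum.elim (.inr ∘ .inl ∘ s) (Sum.elim (.inl ∘ t) (.inr ∘ .inr ∘ σ))) ?_ ?_
  · rintro (a | b | w) (a' | b' | w') h <;> simp_all
  · rintro (a | b | w) (a' | b' | w') h <;> simp_all [_root_.splitCompose]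
    simpa [h] using not_congr (σ.map_adj_iff (v := w) (w := w'))

variable [Fintype α] [Fintype β] [Fintype W]

open Classical in
/-- The bipartite graph `R` is regular of degree `k` with both classes of size `2k`; equivalently,
`R` and its bipartite complement are regular of the same degree. -/
structure HalfRegular (R : α → β → Prop) (k : ℕ) : Prop where
  card_left : Fintype.card α = 2 * k
  card_right : Fintype.card β = 2 * k
  card_row : ∀ a, #{b | R a b} = k
  card_col : ∀ b, #{a | R a b} = k

theorem HalfRegular.swap (hR : HalfRegular R k) : HalfRegular (fun b a => R a b) k :=
  ⟨hR.card_right, hR.card_left, hR.card_col, hR.card_row⟩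

theorem HalfRegular.degreeIn_inl (hR : HalfRegular R k) (a : α) :
    degreeIn (splitCompose R H) (.inl a) univ = 3 * k - 1 + Fintype.card W := by
  classical
  have : 0 < Fintype.card α := Fintype.card_pos_iff.2 ⟨a⟩
  have := hR.card_left
  rw [degreeIn_univ_sum (p := fun a' => a ≠ a') (q := R a) (r := fun _ => True)
    (fun _ => Iff.rfl) (fun _ => Iff.rfl) (fun _ => Iff.rfl), hR.card_row, filter_ne,
    card_erase_of_mem (mem_univ a), filter_true, card_univ, card_univ]
  omega

theorem HalfRegular.degreeIn_inr_inl (hR : HalfRegular R k) (b : β) :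
    degreeIn (splitCompose R H) (.inr (.inl b)) univ = k := by
  classical
  rw [degreeIn_univ_sum (p := fun a => R a b) (q := fun _ => False) (r := fun _ => False)
    (fun _ => Iff.rfl) (fun _ => Iff.rfl) (fun _ => Iff.rfl), hR.card_col, filter_false,
    filter_false, card_empty, card_empty, add_zero, add_zero]

theorem HalfRegular.degreeIn_inr_inr (hR : HalfRegular R k) (w : W) :
    degreeIn (splitCompose R H) (.inr (.inr w)) univ = 2 * k + degreeIn H w univ := by
  classical
  rw [degreeIn_univ_sum (p := fun _ => True) (q := fun _ => False) (r := H.Adj w)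
    (fun _ => Iff.rfl) (fun _ => Iff.rfl) (fun _ => Iff.rfl), filter_true, card_univ,
    hR.card_left, filter_false, card_empty, degreeIn_eq_card_filter]
  omega

/-- The degrees of the composition of a split graph, with classes of size `2k` and all cross degrees
`k`, with a graph whose degrees are the entries of `D`. -/
def splitExtension (k : ℕ) (D : Multiset ℕ) : Multiset ℕ :=
  Multiset.replicate (2 * k) (3 * k - 1 + D.card) + Multiset.replicate (2 * k) k +
    D.map (2 * k + ·)

theorem splitExtension_injective (k : ℕ) : (splitExtension k).Injective := by
  intro D D' h
  have hcard : D.card = D'.card := by simpa [splitExtension] using congrArg Multiset.card h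
  rw [splitExtension, splitExtension, hcard, Multiset.add_right_inj] at h
  exact Multiset.map_injective (add_right_injective (2 * k)) h

theorem HalfRegular.degreeMultiset_splitCompose (hR : HalfRegular R k) :
    degreeMultiset (splitCompose R H) = splitExtension k (degreeMultiset H) := by
  simp only [degreeMultiset_sum, hR.degreeIn_inl, hR.degreeIn_inr_inl, hR.degreeIn_inr_inr,
    splitExtension, card_degreeMultiset, Multiset.map_const', card_val, card_univ, hR.card_left,
    hR.card_right]
  rw [degreeMultiset, Multiset.map_map]
  rfl

end splitCompose

section splitComposeComplement

variable {α β W : Type} [Fintype α] [Fintype β] [Finite W] {R : α → β → Prop} {H : SimpleGraph W}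
  {k : ℕ}

theorem HalfRegular.forall_exists_apply_eq (hR : HalfRegular R k) (hk : 1 ≤ k)
    (σ : splitCompose R H ≃g (splitCompose R H)ᶜ) :
    (∀ a, ∃ b, σ (.inl a) = .inr (.inl b)) ∧ (∀ b, ∃ a, σ (.inr (.inl b)) = .inl a) ∧
      ∀ w, ∃ w', σ (.inr (.inr w)) = .inr (.inr w') := by
  have := Fintype.ofFinite W
  have hsum := degreeIn_apply_add_degreeIn σ
  have hcard : Fintype.card (α ⊕ β ⊕ W) = 4 * k + Fintype.card W := by
    rw [Fintype.card_sum, Fintype.card_sum, hR.card_left, hR.card_right]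
    omega
  have hα (a : α) := hR.degreeIn_inl (H := H) a
  have hβ (b : β) := hR.degreeIn_inr_inl (H := H) b
  have hW (w : W) : 2 * k ≤ degreeIn (splitCompose R H) (.inr (.inr w)) univ ∧
      degreeIn (splitCompose R H) (.inr (.inr w)) univ < 2 * k + Fintype.card W := by
    have := hR.degreeIn_inr_inr (H := H) w
    have := degreeIn_compl_univ H w
    omega
  refine ⟨fun a => ?_, fun b => ?_, fun w => ?_⟩
  · have := hsum (.inl a)
    cases h : σ (.inl a) <;> grind
  · have := hsum (.inr (.inl b))
    cases h : σ (.inr (.inl b)) <;> grind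
  · have := hsum (.inr (.inr w))
    cases h : σ (.inr (.inr w)) <;> grind

theorem HalfRegular.isSelfComplementary_splitCompose_iff (hR : HalfRegular R k) (hk : 1 ≤ k) :
    IsSelfComplementary (splitCompose R H) ↔ IsSelfComplementaryRel R ∧ IsSelfComplementary H := by
  refine ⟨fun ⟨σ⟩ => ?_, fun h => h.1.splitCompose h.2⟩
  obtain ⟨hα, hβ, hW⟩ := hR.forall_exists_apply_eq hk σ
  choose s hs using hα
  choose t ht using hβ
  choose g hg using hW
  have hs_inj : s.Injective := fun a a' h => Sum.inl_injective (σ.injective (by rw [hs, hs, h]))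
  have ht_inj : t.Injective := fun b b' h =>
    Sum.inl_injective (Sum.inr_injective (σ.injective (by rw [ht, ht, h])))
  have hg_inj : g.Injective := fun w w' h =>
    Sum.inr_injective (Sum.inr_injective (σ.injective (by rw [hg, hg, h])))
  have hcard : Fintype.card α = Fintype.card β := hR.card_left.trans hR.card_right.symm
  refine ⟨⟨.ofBijective s ((Fintype.bijective_iff_injective_and_card s).2 ⟨hs_inj, hcard⟩),
    .ofBijective t ((Fintype.bijective_iff_injective_and_card t).2 ⟨ht_inj, hcard.symm⟩),
    fun a b => ?_⟩, isSelfComplementary_of_injective hg_inj fun w w' h => ?_⟩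
  · have := σ.map_adj_iff (v := .inl a) (w := .inr (.inl b))
    rw [hs, ht] at this
    simpa [splitCompose] using not_congr this
  · have := σ.map_adj_iff (v := .inr (.inr w)) (w := .inr (.inr w'))
    rw [hg, hg] at this
    simpa [splitCompose, h, hg_inj.ne h] using not_congr this

end splitComposeComplement

section Decomposition

variable {V : Type} {G : SimpleGraph V} {A B : Finset V} {k : ℕ}

theorem nonempty_splitCompose_iso (hAB : Disjoint A B)
    (hA : ∀ a ∈ A, ∀ x ∉ B, a ≠ x → G.Adj a x) (hB : ∀ b ∈ B, ∀ y ∉ A, ¬ G.Adj b y) :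
    Nonempty (splitCompose (fun (a : A) (b : B) => G.Adj a b)
      (G.induce {v | v ∉ A ∧ v ∉ B}) ≃g G) := by
  classical
  have hnotMem := disjoint_left.1 hAB
  let φ : A ⊕ B ⊕ {v | v ∉ A ∧ v ∉ B} → V :=
    Sum.elim Subtype.val (Sum.elim Subtype.val Subtype.val)
  have hφ : φ.Bijective := by
    constructor
    · rintro (⟨a, ha⟩ | ⟨a, ha⟩ | ⟨a, ha⟩) (⟨b, hb⟩ | ⟨b, hb⟩ | ⟨b, hb⟩) (rfl : a = b) <;>
        grind
    · intro v
      by_cases hvA : v ∈ A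
      · exact ⟨.inl ⟨v, hvA⟩, rfl⟩
      by_cases hvB : v ∈ B
      · exact ⟨.inr (.inl ⟨v, hvB⟩), rfl⟩
      · exact ⟨.inr (.inr ⟨v, hvA, hvB⟩), rfl⟩
  refine ⟨⟨.ofBijective φ hφ, ?_⟩⟩
  rintro (⟨a, ha⟩ | ⟨a, ha⟩ | ⟨a, ha⟩) (⟨b, hb⟩ | ⟨b, hb⟩ | ⟨b, hb⟩) <;>
    simp only [Equiv.ofBijective_apply, φ, Sum.elim_inl, Sum.elim_inr, splitCompose,
      SimpleGraph.comap_adj, Function.Embedding.subtype_apply, ne_eq, Subtype.mk.injEq, iff_true,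
      iff_false]
  · exact ⟨fun h => h.ne, hA a ha b (hnotMem hb)⟩
  all_goals grind [G.adj_comm]

theorem halfRegular_of_degreeIn (hcardA : #A = 2 * k) (hcardB : #B = 2 * k)
    (hA : ∀ a ∈ A, degreeIn G a B = k) (hB : ∀ b ∈ B, degreeIn G b A = k) :
    HalfRegular (fun (a : A) (b : B) => G.Adj a b) k := by
  classical
  refine ⟨by simpa using hcardA, by simpa using hcardB, fun a => ?_, fun b => ?_⟩
  · rw [← hA a a.2, degreeIn_eq_sum, card_filter]
    exact sum_coe_sort B fun b => if G.Adj a b then 1 else 0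
  · rw [← hB b b.2, degreeIn_eq_sum, card_filter]
    simp only [G.adj_comm b]
    exact sum_coe_sort A fun a => if G.Adj a b then 1 else 0

variable [Fintype V]

/-- Each vertex of `A` has at least `k` neighbours in `B` and each vertex of `B` has at most `k`
neighbours in `A`, so counting the edges between `A` and `B` twice gives equality throughout. -/
theorem degreeIn_eq_of_extreme (hAB : Disjoint A B) (hcardA : #A = 2 * k) (hcardB : #B = 2 * k)
    (hA : ∀ a ∈ A, degreeIn Gᶜ a univ = k) (hB : ∀ b ∈ B, degreeIn G b univ = k) :
    (∀ a ∈ A, degreeIn G a B = k) ∧ ∀ b ∈ B, degreeIn G b A = k := by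
  have hle : ∀ b ∈ B, degreeIn G b A ≤ k := fun b hb =>
    (degreeIn_mono (subset_univ A)).trans_eq (hB b hb)
  have hge : ∀ a ∈ A, k ≤ degreeIn G a B := by
    intro a ha
    have := degreeIn_compl_add_degreeIn (G := G) (disjoint_left.1 hAB ha)
    have := (degreeIn_mono (G := Gᶜ) (subset_univ B)).trans_eq (hA a ha)
    omega
  have hsum := sum_degreeIn_comm G A B
  have hsum_le := sum_le_sum hle
  have hsum_ge := sum_le_sum hge
  have hconst : ∑ _a ∈ A, k = ∑ _b ∈ B, k := by simp only [sum_const, hcardA, hcardB]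
  exact ⟨fun a ha => ((sum_eq_sum_iff_of_le hge).1 (by omega) a ha).symm,
    (sum_eq_sum_iff_of_le hle).1 (by omega)⟩

theorem exists_splitCompose_iso {p : ℕ} (hp : #(degreeClass G p) = 2 * k)
    (hk : #(degreeClass G k) = 2 * k) (hpk : p ≠ k) (hcard : p + k + 1 = Fintype.card V) :
    ∃ (α β W : Type) (_ : Fintype α) (_ : Fintype β) (_ : Fintype W) (R : α → β → Prop)
      (H : SimpleGraph W), HalfRegular R k ∧ Nonempty (splitCompose R H ≃g G) := by
  classical
  have hAB := disjoint_degreeClass (G := G) hpk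
  have hA : ∀ a ∈ degreeClass G p, degreeIn Gᶜ a univ = k := by
    intro a ha
    have := mem_degreeClass.1 ha
    have := degreeIn_compl_univ G a
    omega
  have hB : ∀ b ∈ degreeClass G k, degreeIn G b univ = k := fun b => mem_degreeClass.1
  obtain ⟨hAk, hBk⟩ := degreeIn_eq_of_extreme hAB hp hk hA hB
  refine ⟨_, _, _, inferInstance, inferInstance, Fintype.ofFinite _, _, _,
    halfRegular_of_degreeIn hp hk hAk hBk,
    nonempty_splitCompose_iso hAB (fun a ha x hx hax => ?_) fun b hb y hy => ?_⟩
  · have := degreeIn_compl_add_degreeIn (G := G) (disjoint_left.1 hAB ha)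
    have := degreeIn_add_degreeIn_compl Gᶜ a (degreeClass G k)
    have hzero : degreeIn Gᶜ a (degreeClass G k)ᶜ = 0 := by grind
    simpa [hax] using degreeIn_eq_zero_iff.1 hzero x (mem_compl.2 hx)
  · have := degreeIn_add_degreeIn_compl G b (degreeClass G p)
    have hzero : degreeIn G b (degreeClass G p)ᶜ = 0 := by grind
    exact degreeIn_eq_zero_iff.1 hzero y (mem_compl.2 hy)

end Decomposition

section Pairing

variable {α β : Type} [Fintype α] [Fintype β] {R : α → β → Prop} {k : ℕ}

/-- The row of `a` has `k * (k - 1)` coincidences with the `2 * k - 1` other rows, which is too few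
for every other row to have one. -/
theorem HalfRegular.exists_compl_row (hR : HalfRegular R k) (hk : k ≤ 2) (a : α) :
    ∃ a', ∀ b, R a' b ↔ ¬ R a b := by
  classical
  have hk_pos : 0 < 2 * k := hR.card_left ▸ Fintype.card_pos_iff.2 ⟨a⟩
  obtain ⟨a', ha'⟩ : ∃ a', #{b ∈ ({b | R a b} : Finset β) | R a' b} = 0 := by
    by_contra! hne
    have hsum : ∑ a', #{b ∈ ({b | R a b} : Finset β) | R a' b} = k * k := by
      refine (sum_card_bipartiteAbove_eq_sum_card_bipartiteBelow R).trans ?_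
      rw [sum_congr rfl fun b _ => show #(bipartiteBelow R univ b) = k from hR.card_col b,
        sum_const, hR.card_row, smul_eq_mul]
    have hself : #{b ∈ ({b | R a b} : Finset β) | R a b} = k := by
      rw [filter_filter]
      simpa only [and_self] using hR.card_row a
    have hothers : 2 * k - 1 ≤ ∑ a' ∈ univ.erase a, #{b ∈ ({b | R a b} : Finset β) | R a' b} := by
      rw [← hR.card_left, ← card_univ, ← card_erase_of_mem (mem_univ a), card_eq_sum_ones]
      exact sum_le_sum fun a' _ => Nat.one_le_iff_ne_zero.2 (hne a')
    rw [← add_sum_erase univ _ (mem_univ a), hself] at hsum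
    interval_cases k <;> omega
  have hsubset : ({b | R a' b} : Finset β) ⊆ ({b | ¬ R a b} : Finset β) := by
    intro b
    have := (filter_eq_empty_iff.1 (card_eq_zero.1 ha') (x := b))
    grind
  have hcard : #{b | ¬ R a b} ≤ #{b | R a' b} := by
    have := card_filter_add_card_filter_not (s := (univ : Finset β)) (R a)
    rw [hR.card_row, card_univ, hR.card_right] at this
    rw [hR.card_row]
    omega
  refine ⟨a', fun b => ?_⟩
  simpa using Finset.ext_iff.1 (eq_of_subset_of_card_le hsubset hcard) b

theorem HalfRegular.exists_compl_row_ne (hR : HalfRegular R k) (hk : k = 1 ∨ k = 2) :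
    ∃ a a', a ≠ a' ∧ ∀ b, R a' b ↔ ¬ R a b := by
  obtain ⟨a⟩ : Nonempty α := Fintype.card_pos_iff.1 (by have := hR.card_left; omega)
  obtain ⟨a', haa'⟩ := hR.exists_compl_row (by omega) a
  refine ⟨a, a', ?_, haa'⟩
  rintro rfl
  obtain ⟨b⟩ : Nonempty β := Fintype.card_pos_iff.1 (by have := hR.card_right; omega)
  exact iff_not_self (haa' b)

theorem HalfRegular.exists_row_pairing (hR : HalfRegular R k) (hk : k = 1 ∨ k = 2) :
    ∃ e : Fin k × Bool ≃ α, ∀ p i b, R (e (p, !i)) b ↔ ¬ R (e (p, i)) b := by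
  classical
  have hcard : Fintype.card (Fin k × Bool) = Fintype.card α := by
    simp [hR.card_left, mul_comm]
  suffices ∃ g : Fin k × Bool → α, g.Surjective ∧ ∀ p b, R (g (p, true)) b ↔ ¬ R (g (p, false)) b by
    obtain ⟨g, hg, h⟩ := this
    refine ⟨.ofBijective g ((Fintype.bijective_iff_surjective_and_card g).2 ⟨hg, hcard⟩), ?_⟩
    rintro p (_ | _) b <;> simp [h]
  obtain ⟨a, a', hne, haa'⟩ := hR.exists_compl_row_ne hk
  have hrest : #({a, a'}ᶜ : Finset α) = 2 * k - 2 := by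
    rw [card_compl, card_pair hne, hR.card_left]
  have hmem (z : α) : z = a ∨ z = a' ∨ z ∈ ({a, a'}ᶜ : Finset α) := by grind [mem_compl]
  rcases hk with rfl | rfl
  · refine ⟨fun x => cond x.2 a' a, fun z => ?_, fun _ => haa'⟩
    rw [card_eq_zero.1 hrest] at hmem
    rcases hmem z with rfl | rfl | hz
    exacts [⟨(0, false), rfl⟩, ⟨(0, true), rfl⟩, absurd hz (notMem_empty z)]
  · obtain ⟨c, c', hcc', hpair⟩ := card_eq_two.1 hrest
    have hcompl : ∀ b, R c' b ↔ ¬ R c b := by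
      intro b
      have hcol := hR.card_col b
      rw [card_filter, ← sum_add_sum_compl {a, a'}, hpair, sum_pair hne, sum_pair hcc'] at hcol
      grind
    refine ⟨fun x => ![cond x.2 a' a, cond x.2 c' c] x.1, fun z => ?_,
      Fin.forall_fin_two.2 ⟨haa', hcompl⟩⟩
    rw [hpair] at hmem
    simp only [mem_insert, mem_singleton] at hmem
    rcases hmem z with rfl | rfl | rfl | rfl
    exacts [⟨(0, false), rfl⟩, ⟨(0, true), rfl⟩, ⟨(1, false), rfl⟩, ⟨(1, true), rfl⟩]

theorem exists_xor_eq_xor (hk : k = 1 ∨ k = 2) (m : Fin k → Fin k → Bool) :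
    ∃ σ : Fin k → Bool, ∀ p q, (m q p ^^ m p q) = (σ p ^^ σ q) := by
  rcases hk with rfl | rfl <;> revert m <;> decide

/-- Up to complementing rows and columns, `R` is a `k × k` matrix `m` over `𝔽₂`. The shifts of the
two pairings by `σ` and by `1 + σ` turn `m` into the complement of its transpose when
`m + mᵀ = σ p + σ q`. -/
theorem HalfRegular.isSelfComplementaryRel (hR : HalfRegular R k) (hk : k = 1 ∨ k = 2) :
    IsSelfComplementaryRel R := by
  classical
  obtain ⟨e, he⟩ := hR.exists_row_pairing hk
  obtain ⟨f, hf⟩ := hR.swap.exists_row_pairing hk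
  let m (p q : Fin k) : Bool := R (e (p, false)) (f (q, false))
  have hm (p q : Fin k) (i j : Bool) : R (e (p, i)) (f (q, j)) ↔ (m p q ^^ i ^^ j) = true := by
    have hrow := he p false
    have hcol := hf q false
    rw [Bool.not_false] at hrow hcol
    cases i <;> cases j <;> simp [m, hrow, hcol]
  obtain ⟨σ, hσ⟩ := exists_xor_eq_xor hk m
  have hs : Function.Involutive fun x : Fin k × Bool => (x.1, x.2 ^^ σ x.1) := by
    intro x; simp
  have ht : Function.Involutive fun x : Fin k × Bool => (x.1, x.2 ^^ !σ x.1) := by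
    intro x; simp
  refine ⟨e.symm.trans (hs.toPerm.trans f), f.symm.trans (ht.toPerm.trans e), fun a b => ?_⟩
  obtain ⟨⟨p, i⟩, rfl⟩ := e.surjective a
  obtain ⟨⟨q, j⟩, rfl⟩ := f.surjective b
  have := hσ p q
  simp only [Equiv.trans_apply, Equiv.symm_apply_apply, Function.Involutive.coe_toPerm, hm]
  generalize m p q = x, m q p = y, σ p = u, σ q = v at this
  revert this
  decide +revert

end Pairing

section twinColumns

variable (k : ℕ) [NeZero k]

/-- A half-regular relation whose rows come in complementary pairs and are pairwise distinct, while
all columns `.inl j` with `j ≠ 0` are equal. -/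
def twinColumns : Fin k × Bool → Fin k ⊕ Fin k → Prop
  | (_, ε), .inl j => j ≠ 0 ↔ ε
  | (i, ε), .inr j => i = j ↔ ε

theorem halfRegular_twinColumns : HalfRegular (twinColumns k) k := by
  classical
  have : 0 < k := NeZero.pos k
  refine ⟨by simp [mul_comm], by simp [two_mul], ?_, ?_⟩
  · rintro ⟨i, ε⟩
    rw [card_filter, Fintype.sum_sum_type, ← card_filter, ← card_filter]
    cases ε
    · simp only [twinColumns, Bool.false_eq_true, iff_false, ne_eq, Decidable.not_not, filter_eq',
        mem_univ, if_true, card_singleton, filter_ne, card_erase_of_mem, card_univ,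
        Fintype.card_fin]
      omega
    · simp only [twinColumns, iff_true, ne_eq, filter_ne', mem_univ, card_erase_of_mem, card_univ,
        Fintype.card_fin, filter_eq, if_true, card_singleton]
      omega
  · intro c
    rw [card_filter, Fintype.sum_prod_type]
    rw [Fintype.sum_congr _ (fun _ => 1), Fin.sum_const, smul_eq_mul, mul_one]
    intro i
    rw [Fintype.sum_bool]
    cases c <;> simp only [twinColumns] <;> split_ifs <;> simp_all

theorem not_isSelfComplementaryRel_twinColumns (hk : 3 ≤ k) :
    ¬ IsSelfComplementaryRel (twinColumns k) := by
  intro h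
  obtain ⟨⟨i, ε⟩, ⟨i', ε'⟩, hne, hrow⟩ := h.exists_equal_rows
    (b := .inl ⟨1, by omega⟩) (b' := .inl ⟨2, by omega⟩) (by simp)
    (fun a => by simp [twinColumns, Fin.ext_iff])
  obtain rfl : ε = ε' := by simpa [twinColumns] using hrow (.inl 0)
  have := hrow (.inr i)
  grind [twinColumns]

end twinColumns

section forces

variable {k : ℕ}

theorem exists_splitCompose_iso_of_degreeMultiset {V W : Type} [Fintype V] [Fintype W]
    {G : SimpleGraph V} {H : SimpleGraph W} (hk : 1 ≤ k)
    (hG : degreeMultiset G = splitExtension k (degreeMultiset H)) :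
    ∃ (α β W' : Type) (_ : Fintype α) (_ : Fintype β) (_ : Fintype W') (R : α → β → Prop)
      (H' : SimpleGraph W'), HalfRegular R k ∧ degreeMultiset H' = degreeMultiset H ∧
        Nonempty (splitCompose R H' ≃g G) := by
  have hcard : Fintype.card V = 4 * k + Fintype.card W := by
    rw [← card_degreeMultiset G, hG, splitExtension, Multiset.card_add, Multiset.card_add,
      Multiset.card_replicate, Multiset.card_replicate, Multiset.card_map, card_degreeMultiset]
    omega
  have hcount (r : ℕ) (hr : r = 3 * k - 1 + Fintype.card W ∨ r = k) :
      #(degreeClass G r) = 2 * k := by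
    have hnotMem : r ∉ (degreeMultiset H).map (2 * k + ·) := by
      simp only [Multiset.mem_map, mem_degreeMultiset]
      rintro ⟨_, ⟨w, rfl⟩, hw⟩
      have := degreeIn_compl_univ H w
      omega
    rw [← count_degreeMultiset, hG, splitExtension, Multiset.count_add, Multiset.count_add,
      Multiset.count_replicate, Multiset.count_replicate, Multiset.count_eq_zero.2 hnotMem,
      card_degreeMultiset]
    split_ifs <;> omega
  obtain ⟨α, β, W', _, _, _, R, H', hR, ⟨e⟩⟩ := exists_splitCompose_iso
    (hcount _ (.inl rfl)) (hcount _ (.inr rfl)) (by omega) (by omega)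
  have hH' : degreeMultiset H' = degreeMultiset H := splitExtension_injective k <| by
    rw [← hR.degreeMultiset_splitCompose, degreeMultiset_iso e, hG]
  exact ⟨α, β, W', inferInstance, inferInstance, inferInstance, R, H', hR, hH', ⟨e⟩⟩

theorem forcesSelfComplementary_splitExtension_iff {W : Type} [Fintype W] (H : SimpleGraph W)
    (hk : 1 ≤ k) : ForcesSelfComplementary (splitExtension k (degreeMultiset H)) ↔
      (k = 1 ∨ k = 2) ∧ ForcesSelfComplementary (degreeMultiset H) := by
  have : NeZero k := ⟨by omega⟩
  constructor
  · intro h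
    have hsc {W' : Type} [Fintype W'] (H' : SimpleGraph W')
        (hH' : degreeMultiset H' = degreeMultiset H) :=
      ((halfRegular_twinColumns k).isSelfComplementary_splitCompose_iff hk).1
        (h _ (splitCompose (twinColumns k) H')
          (by rw [(halfRegular_twinColumns k).degreeMultiset_splitCompose, hH']))
    refine ⟨?_, fun W' _ H' hH' => (hsc H' hH').2⟩
    by_contra! hk'
    exact not_isSelfComplementaryRel_twinColumns k (by omega) (hsc H rfl).1
  · rintro ⟨hk', hforces⟩ V _ G hG
    obtain ⟨α, β, W', _, _, _, R, H', hR, hH', ⟨e⟩⟩ :=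
      exists_splitCompose_iso_of_degreeMultiset hk hG
    exact IsSelfComplementary.of_iso e
      ((hR.isSelfComplementaryRel hk').splitCompose (hforces W' H' hH'))

end forces

section Pentagon

variable {V : Type} {G : SimpleGraph V} {S : Finset V} {u w : V}

theorem degreeIn_univ_lt_card_of_closed [Fintype V] (hu : u ∈ S)
    (hS : ∀ z, G.Adj u z → z ∈ S) : degreeIn G u univ < #S := by
  classical
  rw [degreeIn_eq_card_filter]
  refine card_lt_card (Finset.ssubset_iff_subset_ne.2 ⟨fun z hz => hS z (mem_filter.1 hz).2, ?_⟩)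
  rintro rfl
  simp at hu

theorem eq_univ_of_closed [Fintype V] {d : ℕ} (hV : Fintype.card V ≤ 2 * d + 1)
    (hd : ∀ v, d ≤ degreeIn G v univ) (hne : S.Nonempty)
    (hS : ∀ u ∈ S, ∀ w, G.Adj u w → w ∈ S) : S = univ := by
  classical
  obtain ⟨u, hu⟩ := hne
  refine eq_univ_of_forall fun z => ?_
  by_contra hz
  have := hd u
  have := hd z
  have := degreeIn_univ_lt_card_of_closed hu (hS u hu)
  have := degreeIn_univ_lt_card_of_closed (mem_compl.2 hz) fun w hw =>
    mem_compl.2 fun hwS => hz (hS w hwS z hw.symm)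
  have := card_add_card_compl S
  omega

theorem exists_adj_iff_of_degreeIn_eq_two [Fintype V] (hu : degreeIn G u univ = 2) :
    ∃ a b, a ≠ b ∧ ∀ z, G.Adj u z ↔ z = a ∨ z = b := by
  classical
  rw [degreeIn_eq_card_filter] at hu
  obtain ⟨a, b, hab, h⟩ := card_eq_two.1 hu
  exact ⟨a, b, hab, by simpa [Finset.ext_iff] using h⟩

theorem exists_adj_iff_of_adj [Fintype V] (hu : degreeIn G u univ = 2) (hw : G.Adj u w) :
    ∃ w', w' ≠ w ∧ ∀ z, G.Adj u z ↔ z = w ∨ z = w' := by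
  obtain ⟨a, b, hab, h⟩ := exists_adj_iff_of_degreeIn_eq_two hu
  obtain rfl | rfl := (h w).1 hw
  · exact ⟨b, hab.symm, h⟩
  · exact ⟨a, hab, fun z => (h z).trans or_comm⟩

/-- The walks from `v` along its two edges cannot meet before they have visited all five vertices,
since a nonempty set closed under adjacency is everything. -/
theorem exists_induced_path [Fintype V] (hV : Fintype.card V = 5)
    (hdeg : ∀ v, degreeIn G v univ = 2) (v : V) :
    ∃ a b c d, [v, a, b, c, d].Nodup ∧ (∀ z, G.Adj v z ↔ z = a ∨ z = b) ∧
      (∀ z, G.Adj a z ↔ z = v ∨ z = c) ∧ ∀ z, G.Adj b z ↔ z = v ∨ z = d := by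
  classical
  have hclosed {S : Finset V} (hne : S.Nonempty) (hS : ∀ u ∈ S, ∀ w, G.Adj u w → w ∈ S) :
      #S = 5 := by
    rw [eq_univ_of_closed hV.le (fun v => (hdeg v).ge) hne hS, card_univ, hV]
  obtain ⟨a, b, hab, hv⟩ := exists_adj_iff_of_degreeIn_eq_two (hdeg v)
  have hva := (hv a).2 (.inl rfl)
  have hvb := (hv b).2 (.inr rfl)
  obtain ⟨c, hcv, ha⟩ := exists_adj_iff_of_adj (hdeg a) hva.symm
  obtain ⟨d, hdv, hb⟩ := exists_adj_iff_of_adj (hdeg b) hvb.symm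
  have hac := (ha c).2 (.inr rfl)
  have hbd := (hb d).2 (.inr rfl)
  have hne := And.intro (And.intro hva.ne hvb.ne) (And.intro hac.ne hbd.ne)
  have hcb : c ≠ b := by
    rintro rfl
    have := hclosed (S := {v, a, c}) (by simp) (by grind [G.adj_comm])
    grind [card_le_three (a := v) (b := a) (c := c)]
  have hcd : c ≠ d := by
    rintro rfl
    obtain ⟨e, -, hc⟩ := exists_adj_iff_of_adj (hdeg c) hac.symm
    have := hclosed (S := {v, a, c, b}) (by simp) (by grind [G.adj_comm])
    grind [card_le_four (a := v) (b := a) (c := c) (d := b)]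
  have hda : d ≠ a := by grind [G.adj_comm]
  exact ⟨a, b, c, d, by grind, hv, ha, hb⟩

theorem nonempty_cycleGraph_five_iso [Fintype V] (hV : Fintype.card V = 5)
    (hdeg : ∀ v, degreeIn G v univ = 2) : Nonempty (SimpleGraph.cycleGraph 5 ≃g G) := by
  classical
  obtain ⟨v⟩ : Nonempty V := Fintype.card_pos_iff.1 (by omega)
  obtain ⟨a, b, c, d, hnodup, hv, ha, hb⟩ := exists_induced_path hV hdeg v
  have huniv (z : V) : z = v ∨ z = a ∨ z = b ∨ z = c ∨ z = d := by
    have hcard : #([v, a, b, c, d].toFinset) = 5 := List.toFinset_card_of_nodup hnodup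
    have hz : z ∈ [v, a, b, c, d].toFinset :=
      (eq_univ_of_card _ (hcard.trans hV.symm)).symm ▸ mem_univ z
    simpa using hz
  obtain ⟨e, hea, hc⟩ := exists_adj_iff_of_adj (hdeg c) ((ha c).2 (.inr rfl)).symm
  obtain ⟨f, hfb, hd⟩ := exists_adj_iff_of_adj (hdeg d) ((hb d).2 (.inr rfl)).symm
  have hce := (hc e).2 (.inr rfl)
  have hdf := (hd f).2 (.inr rfl)
  obtain rfl : e = d := by grind [huniv e, hce.ne, G.adj_comm]
  obtain rfl : f = c := by grind [huniv f, hdf.ne, G.adj_comm]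
  let x : Fin 5 → V := ![v, a, f, e, b]
  have hx : x.Bijective := by
    refine (Fintype.bijective_iff_surjective_and_card x).2 ⟨fun z => ?_, by simp [hV]⟩
    rcases huniv z with rfl | rfl | rfl | rfl | rfl
    exacts [⟨0, rfl⟩, ⟨1, rfl⟩, ⟨4, rfl⟩, ⟨2, rfl⟩, ⟨3, rfl⟩]
  have hadj : ∀ i z, G.Adj (x i) z ↔ z = x (i + 1) ∨ z = x (i - 1) := by
    intro i z
    fin_cases i
    exacts [hv z, (ha z).trans or_comm, (hc z).trans or_comm, hd z, hb z]
  refine ⟨⟨.ofBijective x hx, fun {i j} => ?_⟩⟩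
  rw [Equiv.ofBijective_apply, Equiv.ofBijective_apply, hadj, hx.1.eq_iff, hx.1.eq_iff,
    SimpleGraph.cycleGraph_adj]
  grind

theorem isSelfComplementary_of_two_regular [Fintype V] (hV : Fintype.card V = 5)
    (hdeg : ∀ v, degreeIn G v univ = 2) : IsSelfComplementary G := by
  obtain ⟨e⟩ := nonempty_cycleGraph_five_iso hV hdeg
  obtain ⟨e'⟩ := nonempty_cycleGraph_five_iso (G := Gᶜ) hV fun v => by
    have := degreeIn_compl_univ G v
    have := hdeg v
    omega
  exact ⟨e.symm.trans e'⟩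

end Pentagon

section Regular

variable {V : Type} [Fintype V] {G : SimpleGraph V} {m r : ℕ}

theorem even_mul_of_degreeMultiset_eq_replicate (hG : degreeMultiset G = .replicate m r) :
    Even (m * r) := by
  classical
  have := congrArg Multiset.sum hG
  simp only [degreeMultiset, degreeIn_univ, Multiset.sum_replicate, smul_eq_mul] at this
  rw [← this]
  exact ⟨#G.edgeFinset, (G.sum_degrees_eq_twice_card_edges).trans (two_mul _)⟩

theorem forcesSelfComplementary_replicate_iff (hG : degreeMultiset G = .replicate m r)
    (hm : 0 < m) : ForcesSelfComplementary (.replicate m r) ↔ (m = 1 ∨ m = 5) ∧ m = 2 * r + 1 := by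
  constructor
  · intro h
    have hmem : r ∈ degreeMultiset G := by
      rw [hG]
      exact Multiset.mem_replicate.2 ⟨hm.ne', rfl⟩
    have hdeg (v : V) : degreeIn G v univ = r :=
      Multiset.eq_of_mem_replicate (hG ▸ mem_degreeMultiset.2 ⟨v, rfl⟩)
    have hcard : Fintype.card V = m := by
      rw [← card_degreeMultiset G, hG, Multiset.card_replicate]
    have hrr := (h V G hG).add_add_one_eq_card hmem hmem (fun v => (hdeg v).le)
      fun v => (hdeg v).ge
    obtain ⟨k, rfl⟩ : Even r := by
      have := even_mul_of_degreeMultiset_eq_replicate hG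
      grind
    suffices k < 2 by omega
    by_contra! hk
    refine not_isSelfComplementary_matchedCrown (ι := Fin k) (W := Unit) (by simpa using hk)
      (h _ _ ?_)
    rw [degreeMultiset_matchedCrown, Fintype.card_fin, Fintype.card_unit,
      Nat.sub_add_cancel (by omega), ← Multiset.replicate_add]
    congr 1 <;> omega
  · rintro ⟨hm', rfl⟩ W _ H hH
    have hdeg (w : W) : degreeIn H w univ = r :=
      Multiset.eq_of_mem_replicate (hH ▸ mem_degreeMultiset.2 ⟨w, rfl⟩)
    have hcard : Fintype.card W = 2 * r + 1 := by
      rw [← card_degreeMultiset H, hH, Multiset.card_replicate]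
    obtain rfl | rfl : r = 0 ∨ r = 2 := by omega
    · have := Fintype.card_le_one_iff_subsingleton.1 hcard.le
      exact isSelfComplementary_of_injective Function.injective_id
        fun u v huv => absurd (Subsingleton.elim u v) huv
    · exact isSelfComplementary_of_two_regular hcard hdeg

end Regular

section CompactSequence

variable {ℓ k : ℕ} {d d' n : ℕ → ℕ}

theorem sum_Icc_one_succ {M : Type*} [AddCommMonoid M] (f : ℕ → M) (ℓ : ℕ) :
    ∑ i ∈ Icc 1 (ℓ + 1), f i = f 1 + ∑ i ∈ Icc 1 ℓ, f (i + 1) := by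
  rw [← add_sum_Ioc_eq_sum_Icc (by omega), ← sum_image (add_left_injective 1).injOn,
    image_add_right_Icc]
  rfl

theorem sum_Icc_one_add_two {M : Type*} [AddCommMonoid M] (f : ℕ → M) (ℓ : ℕ) :
    ∑ i ∈ Icc 1 (ℓ + 2), f i = f 1 + f (ℓ + 2) + ∑ i ∈ Icc 1 ℓ, f (i + 1) := by
  rw [sum_Icc_succ_top (by omega), sum_Icc_one_succ, add_right_comm]

theorem coe_compactSequence (ℓ : ℕ) (d n : ℕ → ℕ) :
    (compactSequence ℓ d n : Multiset ℕ) = ∑ i ∈ Icc 1 ℓ, .replicate (n i) (d i) := by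
  induction ℓ with
  | zero => rfl
  | succ ℓ ih =>
    rw [sum_Icc_succ_top (by omega), ← ih]
    simp [compactSequence, List.range'_concat, ← Multiset.coe_add, ← Multiset.coe_replicate,
      add_comm]

theorem card_compactSequence (ℓ : ℕ) (d n : ℕ → ℕ) :
    (compactSequence ℓ d n : Multiset ℕ).card = ∑ i ∈ Icc 1 ℓ, n i := by
  simp only [coe_compactSequence, Multiset.card_sum, Multiset.card_replicate]

theorem count_compactSequence (hd : StrictAntiOn d (Set.Icc 1 ℓ)) {i : ℕ}
    (hi : i ∈ Set.Icc 1 ℓ) : (compactSequence ℓ d n : Multiset ℕ).count (d i) = n i := by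
  have hi' : i ∈ Icc 1 ℓ := by simpa using hi
  rw [coe_compactSequence, Multiset.count_sum', sum_eq_single_of_mem i hi',
    Multiset.count_replicate_self]
  intro j hj hji
  rw [Multiset.count_replicate, if_neg fun h => hji (hd.injOn (by simpa using hj) hi h)]

theorem mem_compactSequence {x : ℕ} (hn : ∀ i ∈ Set.Icc 1 ℓ, 1 ≤ n i) :
    x ∈ (compactSequence ℓ d n : Multiset ℕ) ↔ ∃ i ∈ Set.Icc 1 ℓ, d i = x := by
  simp only [coe_compactSequence, Multiset.mem_sum, Multiset.mem_replicate, mem_Icc, Set.mem_Icc]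
  refine exists_congr fun i => and_congr_right fun hi => ?_
  rw [and_iff_right (Nat.one_le_iff_ne_zero.1 (hn i hi)), eq_comm]

theorem pairwise_ge_compactSequence (hd : StrictAntiOn d (Set.Icc 1 ℓ)) :
    (compactSequence ℓ d n).Pairwise (· ≥ ·) := by
  refine List.pairwise_flatMap.2 ⟨fun i _ => ?_, ?_⟩
  · exact List.pairwise_replicate.2 (.inr le_rfl)
  · refine (List.pairwise_lt_range' (s := 1) (n := ℓ)).imp_of_mem fun hi hj hij x hx y hy => ?_
    rw [List.eq_of_mem_replicate hx, List.eq_of_mem_replicate hy]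
    rw [List.mem_range'_1] at hi hj
    exact (hd ⟨hi.1, by omega⟩ ⟨hj.1, by omega⟩ hij).le

theorem degreeSequence_eq_iff {V : Type} [Fintype V] (G : SimpleGraph V) {τ : List ℕ}
    (hτ : τ.Pairwise (· ≥ ·)) : degreeSequence G = τ ↔ degreeMultiset G = τ := by
  classical
  have hsort : degreeSequence G = (degreeMultiset G).sort (· ≥ ·) := by
    simp only [degreeSequence, degreeMultiset, degreeIn_univ]
  rw [hsort]
  refine ⟨fun h => by rw [← h, Multiset.sort_eq], fun h => ?_⟩
  refine List.Perm.eq_of_pairwise' (Multiset.pairwise_sort _ _) hτ ?_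
  rw [← Multiset.coe_eq_coe, Multiset.sort_eq, h]

theorem isForciblySelfComplementary_iff {τ : List ℕ} (hτ : τ.Pairwise (· ≥ ·)) :
    IsForciblySelfComplementary τ ↔ ForcesSelfComplementary τ :=
  forall₃_congr fun _ _ G => by rw [degreeSequence_eq_iff G hτ]

theorem splitExtension_compactSequence (hd' : ∀ i ∈ Set.Icc 1 ℓ, d (i + 1) = 2 * k + d' i)
    (hn₁ : n 1 = 2 * k) (hn₂ : n (ℓ + 2) = 2 * k)
    (hd₁ : d 1 = 3 * k - 1 + ∑ i ∈ Icc 1 ℓ, n (i + 1)) (hd₂ : d (ℓ + 2) = k) :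
    splitExtension k (compactSequence ℓ d' fun i => n (i + 1)) = compactSequence (ℓ + 2) d n := by
  rw [splitExtension, card_compactSequence, coe_compactSequence, coe_compactSequence,
    sum_Icc_one_add_two, hn₁, hn₂, hd₁, hd₂, ← Multiset.coe_mapAddMonoidHom, map_sum]
  refine congrArg _ (sum_congr rfl fun i hi => ?_)
  rw [Multiset.coe_mapAddMonoidHom, Multiset.map_replicate, hd' i (by simpa using hi)]

theorem exists_eq_compactSequence_of_splitExtension_eq {D : Multiset ℕ}
    (hn : ∀ i ∈ Set.Icc 1 (ℓ + 2), 1 ≤ n i)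
    (hD : splitExtension k D = compactSequence (ℓ + 2) d n)
    (hn₁ : n 1 = 2 * k) (hn₂ : n (ℓ + 2) = 2 * k)
    (hd₁ : d 1 = 3 * k - 1 + ∑ i ∈ Icc 1 ℓ, n (i + 1)) (hd₂ : d (ℓ + 2) = k) :
    ∃ d', (∀ i ∈ Set.Icc 1 ℓ, d (i + 1) = 2 * k + d' i) ∧
      D = compactSequence ℓ d' fun i => n (i + 1) := by
  have hcard : D.card = ∑ i ∈ Icc 1 ℓ, n (i + 1) := by
    have := congrArg Multiset.card hD
    rw [card_compactSequence, sum_Icc_one_add_two, splitExtension, Multiset.card_add,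
      Multiset.card_add, Multiset.card_replicate, Multiset.card_replicate,
      Multiset.card_map] at this
    omega
  have hmap : D.map (2 * k + ·) =
      compactSequence ℓ (fun i => d (i + 1)) fun i => n (i + 1) := by
    rw [splitExtension, coe_compactSequence, sum_Icc_one_add_two, hn₁, hn₂, hd₁, hd₂, hcard] at hD
    rw [coe_compactSequence]
    exact add_left_cancel hD
  have hshift : ∀ i ∈ Set.Icc 1 ℓ, d (i + 1) = 2 * k + (d (i + 1) - 2 * k) := by
    intro i hi
    have hmem : d (i + 1) ∈ D.map (2 * k + ·) := by
      rw [hmap, mem_compactSequence fun j hj => hn _ ⟨by omega, by have := hj.2; omega⟩]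
      exact ⟨i, hi, rfl⟩
    obtain ⟨x, -, hx⟩ := Multiset.mem_map.1 hmem
    omega
  refine ⟨_, hshift, splitExtension_injective k (hD.trans ?_)⟩
  exact (splitExtension_compactSequence hshift hn₁ hn₂ hd₁ hd₂).symm

theorem card_degreeClass_of_degreeMultiset_eq {V : Type} [Fintype V] {G : SimpleGraph V}
    (hd : StrictAntiOn d (Set.Icc 1 ℓ)) (hG : degreeMultiset G = compactSequence ℓ d n) {i : ℕ}
    (hi : i ∈ Set.Icc 1 ℓ) : #(degreeClass G (d i)) = n i := by
  rw [← count_degreeMultiset, hG, count_compactSequence hd hi]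

theorem exists_inner_terms {V : Type} [Fintype V] {G : SimpleGraph V}
    (hd : StrictAntiOn d (Set.Icc 1 (ℓ + 2))) (hn : ∀ i ∈ Set.Icc 1 (ℓ + 2), 1 ≤ n i)
    (hG : degreeMultiset G = compactSequence (ℓ + 2) d n)
    (hn₁ : n 1 = 2 * k) (hn₂ : n (ℓ + 2) = 2 * k)
    (hd₁ : d 1 + k + 1 = ∑ i ∈ Icc 1 (ℓ + 2), n i) (hd₂ : d (ℓ + 2) = k) :
    ∃ (d' : ℕ → ℕ) (W : Type) (_ : Fintype W) (H : SimpleGraph W),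
      (∀ i ∈ Set.Icc 1 ℓ, d (i + 1) = 2 * k + d' i) ∧ StrictAntiOn d' (Set.Icc 1 ℓ) ∧
      (degreeMultiset H = compactSequence ℓ d' fun i => n (i + 1)) ∧
      degreeMultiset G = splitExtension k (degreeMultiset H) := by
  have hfirst : 1 ∈ Set.Icc 1 (ℓ + 2) := ⟨le_rfl, by omega⟩
  have hlast : ℓ + 2 ∈ Set.Icc 1 (ℓ + 2) := ⟨by omega, le_rfl⟩
  obtain ⟨_, _, W, _, _, _, _, H, hR, ⟨e⟩⟩ := exists_splitCompose_iso (G := G) (k := k)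
    ((card_degreeClass_of_degreeMultiset_eq hd hG hfirst).trans hn₁)
    (by rw [← hn₂, ← card_degreeClass_of_degreeMultiset_eq hd hG hlast, hd₂])
    (by rw [← hd₂]; exact (hd hfirst hlast (by omega)).ne')
    (by rw [hd₁, ← card_degreeMultiset G, hG, card_compactSequence])
  have hGH : degreeMultiset G = splitExtension k (degreeMultiset H) := by
    rw [← degreeMultiset_iso e, hR.degreeMultiset_splitCompose]
  rw [sum_Icc_one_add_two, hn₁, hn₂] at hd₁
  obtain ⟨d', hd', hH⟩ := exists_eq_compactSequence_of_splitExtension_eq hn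
    (hGH.symm.trans hG) hn₁ hn₂ (by have := hn 1 hfirst; omega) hd₂
  refine ⟨d', W, _, H, hd', fun i hi j hj hij => ?_, hH, hGH⟩
  have := hd (a := i + 1) (b := j + 1) ⟨by omega, by grind⟩ ⟨by omega, by grind⟩ (by omega)
  rw [hd' i hi, hd' j hj] at this
  omega

end CompactSequence

/-- Condition (1) of the characterization at the index `i`, for the sequence
`(d₁^{n₁}, …, d_ℓ^{n_ℓ})` with `N` terms. -/
def RaoPairCondition (ℓ : ℕ) (d n : ℕ → ℕ) (N i : ℕ) : Prop :=
  n (ℓ + 1 - i) = n i ∧ (n i = 2 ∨ n i = 4) ∧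
  (d (ℓ + 1 - i) : ℚ) = (N : ℚ) - 1 - (d i : ℚ) ∧
  (N : ℚ) - 1 - (d i : ℚ) = (∑ j ∈ Icc 1 i, (n j : ℚ)) - (n i : ℚ) / 2

/-- Condition (2) of the characterization, for the sequence `(d₁^{n₁}, …, d_ℓ^{n_ℓ})` with `N`
terms. -/
def RaoMiddleCondition (ℓ : ℕ) (d n : ℕ → ℕ) (N : ℕ) : Prop :=
  Odd ℓ → (n ((ℓ + 1) / 2) = 1 ∨ n ((ℓ + 1) / 2) = 5) ∧
    (d ((ℓ + 1) / 2) : ℚ) = ((N : ℚ) - 1) / 2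

/-- The numerical side of the characterization. -/
def RaoConditions (ℓ : ℕ) (d n : ℕ → ℕ) (N : ℕ) : Prop :=
  (∀ i ∈ Set.Icc 1 (ℓ / 2), RaoPairCondition ℓ d n N i) ∧ RaoMiddleCondition ℓ d n N

section RaoConditions

variable {ℓ k N i : ℕ} {d d' n : ℕ → ℕ}

theorem raoPairCondition_add_two_one :
    RaoPairCondition (ℓ + 2) d n N 1 ↔ ∃ k, (k = 1 ∨ k = 2) ∧
      n 1 = 2 * k ∧ n (ℓ + 2) = 2 * k ∧ d 1 + k + 1 = N ∧ d (ℓ + 2) = k := by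
  simp only [RaoPairCondition, Nat.add_sub_cancel, Icc_self, sum_singleton]
  constructor
  · rintro ⟨hn, hn₁, hd, hd₁⟩
    obtain ⟨k, hk, hn₁⟩ : ∃ k, (k = 1 ∨ k = 2) ∧ n 1 = 2 * k :=
      hn₁.elim (fun h => ⟨1, by omega⟩) fun h => ⟨2, by omega⟩
    refine ⟨k, hk, hn₁, hn.trans hn₁, ?_, ?_⟩ <;> rify [hn₁] at hd hd₁ ⊢
    · linear_combination -hd₁
    · linear_combination hd + hd₁
  · rintro ⟨k, hk, hn₁, hn₂, hd₁, hd₂⟩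
    rw [hn₁, hn₂, ← hd₁, hd₂]
    push_cast
    exact ⟨rfl, by omega, by ring, by ring⟩

theorem raoPairCondition_add_two_add_one (hi : i ∈ Set.Icc 1 (ℓ / 2)) (hn₁ : n 1 = 2 * k)
    (hd' : ∀ i ∈ Set.Icc 1 ℓ, d (i + 1) = 2 * k + d' i) :
    RaoPairCondition (ℓ + 2) d n (N + 4 * k) (i + 1) ↔
      RaoPairCondition ℓ d' (fun i => n (i + 1)) N i := by
  obtain ⟨hi₁, hi₂⟩ := hi
  have hsum : ∑ j ∈ Icc 1 (i + 1), (n j : ℚ) = 2 * k + ∑ j ∈ Icc 1 i, (n (j + 1) : ℚ) := by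
    rw [sum_Icc_one_succ, hn₁]
    push_cast
    rfl
  rw [RaoPairCondition, RaoPairCondition, show ℓ + 2 + 1 - (i + 1) = ℓ + 1 - i + 1 by omega,
    hd' i ⟨hi₁, by omega⟩, hd' (ℓ + 1 - i) ⟨by omega, by omega⟩, hsum]
  push_cast
  refine and_congr_right fun _ => and_congr_right fun _ => and_congr ?_ ?_ <;>
    constructor <;> intro h <;> linear_combination h

theorem raoMiddleCondition_add_two (hd' : ∀ i ∈ Set.Icc 1 ℓ, d (i + 1) = 2 * k + d' i) :
    RaoMiddleCondition (ℓ + 2) d n (N + 4 * k) ↔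
      RaoMiddleCondition ℓ d' (fun i => n (i + 1)) N := by
  have hodd : Odd (ℓ + 2) ↔ Odd ℓ := by simp [Nat.odd_add]
  rw [RaoMiddleCondition, RaoMiddleCondition, hodd,
    show (ℓ + 2 + 1) / 2 = (ℓ + 1) / 2 + 1 by omega]
  refine imp_congr_right fun ⟨m, hm⟩ => and_congr_right fun _ => ?_
  rw [hd' _ ⟨by omega, by omega⟩]
  push_cast
  constructor <;> intro h <;> linear_combination h

theorem raoConditions_add_two (hn₁ : n 1 = 2 * k) (hn₂ : n (ℓ + 2) = 2 * k)
    (hd₁ : d 1 + k + 1 = N + 4 * k) (hd₂ : d (ℓ + 2) = k)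
    (hd' : ∀ i ∈ Set.Icc 1 ℓ, d (i + 1) = 2 * k + d' i) :
    RaoConditions (ℓ + 2) d n (N + 4 * k) ↔
      (k = 1 ∨ k = 2) ∧ RaoConditions ℓ d' (fun i => n (i + 1)) N := by
  have hone : RaoPairCondition (ℓ + 2) d n (N + 4 * k) 1 ↔ k = 1 ∨ k = 2 := by
    refine raoPairCondition_add_two_one.trans ⟨?_, fun h => ⟨k, h, hn₁, hn₂, hd₁, hd₂⟩⟩
    rintro ⟨j, hj, hn₁', -⟩
    omega
  rw [RaoConditions, RaoConditions, raoMiddleCondition_add_two hd', ← hone, ← and_assoc]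
  refine and_congr_left fun _ => ⟨fun h => ⟨h 1 ⟨le_rfl, by omega⟩, fun i hi => ?_⟩, ?_⟩
  · exact (raoPairCondition_add_two_add_one hi hn₁ hd').1 (h _ ⟨by omega, by grind⟩)
  · rintro ⟨hfirst, h⟩ (_ | _ | i) ⟨hi₁, hi₂⟩
    · omega
    · exact hfirst
    · have hi : i + 1 ∈ Set.Icc 1 (ℓ / 2) := ⟨by omega, by omega⟩
      exact (raoPairCondition_add_two_add_one hi hn₁ hd').2 (h _ hi)

theorem raoConditions_one : RaoConditions 1 d n N ↔ (n 1 = 1 ∨ n 1 = 5) ∧ N = 2 * d 1 + 1 := by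
  have hhalf : (d 1 : ℚ) = ((N : ℚ) - 1) / 2 ↔ N = 2 * d 1 + 1 := by
    rw [← Nat.cast_inj (R := ℚ)]
    push_cast
    constructor <;> intro h <;> linarith
  simp [RaoConditions, RaoMiddleCondition, hhalf]

end RaoConditions

section Characterization

theorem forcesSelfComplementary_zero : ForcesSelfComplementary 0 := by
  intro V _ G hG
  have : IsEmpty V := by
    rw [← Fintype.card_eq_zero_iff, ← card_degreeMultiset G, hG, Multiset.card_zero]
  exact ⟨Equiv.refl V, fun {u} => isEmptyElim u⟩

theorem exists_outer_terms {V : Type} [Fintype V] {G : SimpleGraph V} {ℓ : ℕ} {d n : ℕ → ℕ}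
    (hd : StrictAntiOn d (Set.Icc 1 (ℓ + 2))) (hn : ∀ i ∈ Set.Icc 1 (ℓ + 2), 1 ≤ n i)
    (hG : degreeMultiset G = compactSequence (ℓ + 2) d n)
    (hF : ForcesSelfComplementary (degreeMultiset G)) :
    ∃ k, 1 ≤ k ∧ n 1 = 2 * k ∧ n (ℓ + 2) = 2 * k ∧
      d 1 + k + 1 = ∑ i ∈ Icc 1 (ℓ + 2), n i ∧ d (ℓ + 2) = k := by
  have hfirst : 1 ∈ Set.Icc 1 (ℓ + 2) := ⟨le_rfl, by omega⟩
  have hlast : ℓ + 2 ∈ Set.Icc 1 (ℓ + 2) := ⟨by omega, le_rfl⟩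
  have hmem {x : ℕ} : x ∈ degreeMultiset G ↔ ∃ i ∈ Set.Icc 1 (ℓ + 2), d i = x := by
    rw [hG, mem_compactSequence hn]
  have hcount {i : ℕ} (hi : i ∈ Set.Icc 1 (ℓ + 2)) :=
    card_degreeClass_of_degreeMultiset_eq hd hG hi
  have hdeg (v : V) : ∃ i ∈ Set.Icc 1 (ℓ + 2), d i = degreeIn G v univ :=
    hmem.1 (mem_degreeMultiset.2 ⟨v, rfl⟩)
  have hmax (v : V) : degreeIn G v univ ≤ d 1 := by
    obtain ⟨i, hi, h⟩ := hdeg v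
    exact h ▸ hd.antitoneOn hfirst hi hi.1
  have hmin (v : V) : d (ℓ + 2) ≤ degreeIn G v univ := by
    obtain ⟨i, hi, h⟩ := hdeg v
    exact h ▸ hd.antitoneOn hi hlast hi.2
  obtain ⟨k, hk, hn₁, hn₂, hd₂, hd₁⟩ := hF.exists_extreme_degrees (hmem.2 ⟨1, hfirst, rfl⟩)
    (hmem.2 ⟨_, hlast, rfl⟩) hmax hmin (hd hfirst hlast (by omega))
  refine ⟨k, hk, (hcount hfirst).symm.trans hn₁, (hcount hlast).symm.trans hn₂, ?_, hd₂⟩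
  rw [hd₁, ← card_degreeMultiset G, hG, card_compactSequence]

theorem forcesSelfComplementary_compactSequence_iff {V : Type} [Fintype V]
    {G : SimpleGraph V} {ℓ : ℕ} {d n : ℕ → ℕ} (hd : StrictAntiOn d (Set.Icc 1 ℓ))
    (hn : ∀ i ∈ Set.Icc 1 ℓ, 1 ≤ n i) (hG : degreeMultiset G = compactSequence ℓ d n) :
    ForcesSelfComplementary (compactSequence ℓ d n) ↔
      RaoConditions ℓ d n (∑ i ∈ Icc 1 ℓ, n i) := by
  induction ℓ using Nat.twoStepInduction generalizing V d n with
  | zero =>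
    exact iff_of_true forcesSelfComplementary_zero
      ⟨fun i hi => absurd (hi.1.trans hi.2) (by simp), fun h => absurd h (by simp)⟩
  | one =>
    rw [coe_compactSequence, Icc_self, sum_singleton] at hG ⊢
    rw [sum_singleton, forcesSelfComplementary_replicate_iff hG (hn 1 ⟨le_rfl, le_rfl⟩),
      raoConditions_one]
  | more ℓ ih _ =>
    have iff_of_outer_terms {k : ℕ} (hk : 1 ≤ k) (hn₁ : n 1 = 2 * k) (hn₂ : n (ℓ + 2) = 2 * k)
        (hd₁ : d 1 + k + 1 = ∑ i ∈ Icc 1 (ℓ + 2), n i) (hd₂ : d (ℓ + 2) = k) :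
        ForcesSelfComplementary (compactSequence (ℓ + 2) d n) ↔
          RaoConditions (ℓ + 2) d n (∑ i ∈ Icc 1 (ℓ + 2), n i) := by
      obtain ⟨d', W, _, H, hd', hanti, hH, hGH⟩ := exists_inner_terms hd hn hG hn₁ hn₂ hd₁ hd₂
      have hN : ∑ i ∈ Icc 1 (ℓ + 2), n i = ∑ i ∈ Icc 1 ℓ, n (i + 1) + 4 * k := by
        rw [sum_Icc_one_add_two, hn₁, hn₂]
        ring
      rw [← hG, hGH, forcesSelfComplementary_splitExtension_iff H hk, hN,
        raoConditions_add_two hn₁ hn₂ (hd₁.trans hN) hd₂ hd', hH,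
        ih hanti (fun i hi => hn _ ⟨by omega, by grind⟩) hH]
    constructor
    · intro hF
      obtain ⟨k, hk, hn₁, hn₂, hd₁, hd₂⟩ := exists_outer_terms hd hn hG (hG ▸ hF)
      exact (iff_of_outer_terms hk hn₁ hn₂ hd₁ hd₂).1 hF
    · intro hR
      obtain ⟨k, hk, hn₁, hn₂, hd₁, hd₂⟩ :=
        raoPairCondition_add_two_one.1 (hR.1 1 ⟨le_rfl, by omega⟩)
      exact (iff_of_outer_terms (by omega) hn₁ hn₂ hd₁ hd₂).2 hR

end Characterization

theorem mainTheorem2 (ℓ : ℕ) (d n : ℕ → ℕ)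
    (hd : StrictAntiOn d (Set.Icc 1 ℓ))
    (hn : ∀ i ∈ Set.Icc 1 ℓ, 1 ≤ n i)
    (hseq : IsDegreeSequence (compactSequence ℓ d n))
    (N : ℕ) (hN : N = ∑ i ∈ Finset.Icc 1 ℓ, n i) :
    IsForciblySelfComplementary (compactSequence ℓ d n) ↔
      (∀ i ∈ Set.Icc 1 (ℓ / 2),
        n (ℓ + 1 - i) = n i ∧ (n i = 2 ∨ n i = 4) ∧
        (d (ℓ + 1 - i) : ℚ) = (N : ℚ) - 1 - (d i : ℚ) ∧
        (N : ℚ) - 1 - (d i : ℚ) = (∑ j ∈ Finset.Icc 1 i, (n j : ℚ)) - (n i : ℚ) / 2) ∧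
      (Odd ℓ →
        (n ((ℓ + 1) / 2) = 1 ∨ n ((ℓ + 1) / 2) = 5) ∧
        (d ((ℓ + 1) / 2) : ℚ) = ((N : ℚ) - 1) / 2) := by
  subst hN
  obtain ⟨V, _, G, hG⟩ := hseq
  have hsorted := pairwise_ge_compactSequence (n := n) hd
  rw [isForciblySelfComplementary_iff hsorted]
  exact forcesSelfComplementary_compactSequence_iff hd hn
    ((degreeSequence_eq_iff G hsorted).1 hG)
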